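/- Let $F$ be a (real) Banach lattice, with positive cone $F_+$ and dual positive cone $F^*_+$. Vectors $f,g$ are disjoint if $|f|\wedge|g|=0$. The aw-topology (absolute weak topology) on $F$ is the linear topology with zero neighbourhoods generated by $\{f:\nu(|f|)<\varepsilon\}$, and the uaw-topology (unbounded absolute weak topology) the one with zero neighbourhoods generated by $\{f:\nu(h\wedge|f|)<\varepsilon\}$, where $\nu\in F^*_+$, $h\in F_+$, $\varepsilon>0$. A linear topology on $F$ is order continuous if order null nets are null in it; $F$ is order continuous if its norm topology is. If it exists, $\tau_F$ denotes the weakest Hausdorff order continuous locally solid linear topology on $F$. The following conditions are equivalent: (i) $F$ has the positive Schur property: every weakly null sequence in $F_+$ is norm null; (ii) the aw-topology agrees with the norm topology on sequences, i.e. a sequence in $F$ is aw-convergent to $f\in F$ if and only if it is norm convergent to $f$; (iii) $F$ is order continuous (in which case $\tau_F$ exists), and every sequence in $F$ which is both weakly null and $\tau_F$-null is norm null; (iv) every sequence in $F$ which is both weakly null and uaw-null is norm null. Moreover, these conditions imply each of the following: (a) every reflexive closed subspace $E$ of $F$ is dispersed, i.e. there is no almost disjoint sequence in $E$, where $(e_n)$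 is called almost disjoint if $\|e_n\|=1$ for all $n$ and $\|f_n-e_n\|\to0$ for some pairwise disjoint sequence $(f_n)$ in $F$; (b) every tauberian bounded operator $T:F\to H$ into a Banach space $H$ (i.e. $(T^{**})^{-1}(H)\subset F$) is disjointly non-singular, i.e. for every pairwise disjoint sequence of nonzero vectors in $F$ the restriction of $T$ to its span is bounded below on some infinite-dimensional subspace; (c) the closed span of every almost disjoint sequence in $F$ is non-reflexive; (d) the closed span of every pairwise disjoint sequence of nonzero vectors in $F$ is non-reflexive. -/

import Mathlib

open Filter Topology

/-!
Throughout, a (real) Banach lattice is a type `F` with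
`[NormedAddCommGroup F] [Lattice F] [IsOrderedAddMonoid F] [HasSolidNorm F] [NormedSpace ℝ F]
[IsOrderedModule ℝ F] [CompleteSpace F]`.
-/

namespace BanachLattice

section Topologies

variable (F : Type*) [NormedAddCommGroup F] [Lattice F] [IsOrderedAddMonoid F]
  [NormedSpace ℝ F]

/-- The positive cone of the dual: the continuous functionals that are nonnegative on `F₊`. -/
def PosFunctional (ν : StrongDual ℝ F) : Prop := ∀ f : F, 0 ≤ f → 0 ≤ ν f

variable {F} in
theorem PosFunctional.mono {ν : StrongDual ℝ F} (hν : PosFunctional F ν) {f g : F} (h : f ≤ g) :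
    ν f ≤ ν g := by
  have := hν (g - f) (sub_nonneg.2 h)
  rw [map_sub] at this
  linarith

variable {F} in
theorem PosFunctional.add {ν μ : StrongDual ℝ F} (hν : PosFunctional F ν)
    (hμ : PosFunctional F μ) : PosFunctional F (ν + μ) :=
  fun f hf => add_nonneg (hν f hf) (hμ f hf)

/-- The absolute weak topology: the translation invariant topology whose neighbourhoods of zero are
generated by the sets `{f | ν |f| < ε}` with `ν` a positive functional and `ε > 0`. -/
def awTopology : TopologicalSpace F where
  IsOpen U := ∀ f ∈ U, ∃ ν : StrongDual ℝ F, PosFunctional F ν ∧ ∃ ε : ℝ, 0 < ε ∧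
    ∀ g, ν |g - f| < ε → g ∈ U
  isOpen_univ := fun _ _ => ⟨0, fun _ _ => le_rfl, 1, one_pos, fun _ _ => trivial⟩
  isOpen_inter := by
    rintro U V hU hV f ⟨hfU, hfV⟩
    obtain ⟨ν, hν, ε, hε, h⟩ := hU f hfU
    obtain ⟨μ, hμ, δ, hδ, k⟩ := hV f hfV
    refine ⟨ν + μ, hν.add hμ, min ε δ, lt_min hε hδ, fun g hg => ⟨h g ?_, k g ?_⟩⟩
    · have h1 := hμ |g - f| (abs_nonneg _)
      have h2 : ν |g - f| + μ |g - f| < min ε δ := hg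
      linarith [min_le_left ε δ]
    · have h1 := hν |g - f| (abs_nonneg _)
      have h2 : ν |g - f| + μ |g - f| < min ε δ := hg
      linarith [min_le_right ε δ]
  isOpen_sUnion := by
    rintro S hS f ⟨U, hU, hf⟩
    obtain ⟨ν, hν, ε, hε, h⟩ := hS U hU f hf
    exact ⟨ν, hν, ε, hε, fun g hg => ⟨U, hU, h g hg⟩⟩

/-- The unbounded absolute weak topology: the translation invariant topology whose neighbourhoods
of zero are generated by the sets `{f | ν (h ⊓ |f|) < ε}` with `h ≥ 0`, `ν` a positive functional
and `ε > 0`. -/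
def uawTopology : TopologicalSpace F where
  IsOpen U := ∀ f ∈ U, ∃ h : F, 0 ≤ h ∧ ∃ ν : StrongDual ℝ F, PosFunctional F ν ∧
    ∃ ε : ℝ, 0 < ε ∧ ∀ g, ν (h ⊓ |g - f|) < ε → g ∈ U
  isOpen_univ := fun _ _ =>
    ⟨0, le_rfl, 0, fun _ _ => le_rfl, 1, one_pos, fun _ _ => trivial⟩
  isOpen_inter := by
    rintro U V hU hV f ⟨hfU, hfV⟩
    obtain ⟨h, hh, ν, hν, ε, hε, H⟩ := hU f hfU
    obtain ⟨k, hk, μ, hμ, δ, hδ, K⟩ := hV f hfV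
    refine ⟨h ⊔ k, hh.trans le_sup_left, ν + μ, hν.add hμ, min ε δ, lt_min hε hδ,
      fun g hg => ⟨H g ?_, K g ?_⟩⟩
    all_goals
      have h0 : 0 ≤ (h ⊔ k) ⊓ |g - f| := le_inf (hh.trans le_sup_left) (abs_nonneg _)
      have h1 := hμ _ h0
      have h2 := hν _ h0
      have h3 : ν ((h ⊔ k) ⊓ |g - f|) + μ ((h ⊔ k) ⊓ |g - f|) < min ε δ := hg
      have h4 := hν.mono (inf_le_inf_right |g - f| (le_sup_left : h ≤ h ⊔ k))
      have h5 := hμ.mono (inf_le_inf_right |g - f| (le_sup_right : k ≤ h ⊔ k))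
      linarith [min_le_left ε δ, min_le_right ε δ]
  isOpen_sUnion := by
    rintro S hS f ⟨U, hU, hf⟩
    obtain ⟨h, hh, ν, hν, ε, hε, H⟩ := hS U hU f hf
    exact ⟨h, hh, ν, hν, ε, hε, fun g hg => ⟨U, hU, H g hg⟩⟩

variable {F}

theorem abs_sub_le_add (f g k : F) : |k - f| ≤ |k - g| + |g - f| := by
  have : k - f = (k - g) + (g - f) := by abel
  rw [this]
  exact abs_add_le _ _

theorem inf_add_le_add (h a b : F) (hh : 0 ≤ h) (ha : 0 ≤ a) (hb : 0 ≤ b) :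
    h ⊓ (a + b) ≤ h ⊓ a + h ⊓ b := by
  rw [add_inf, inf_add, inf_add]
  exact le_inf (le_inf (inf_le_left.trans (le_add_of_nonneg_right hh))
    (inf_le_left.trans (le_add_of_nonneg_left ha)))
    (le_inf (inf_le_left.trans (le_add_of_nonneg_right hb)) inf_le_right)

theorem mem_nhds_awTopology {U : Set F} {f : F} :
    U ∈ @nhds F (awTopology F) f ↔ ∃ ν : StrongDual ℝ F, PosFunctional F ν ∧
      ∃ ε : ℝ, 0 < ε ∧ ∀ g, ν |g - f| < ε → g ∈ U := by
  rw [@_root_.mem_nhds_iff F (awTopology F) f U]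
  constructor
  · rintro ⟨V, hVU, hV, hf⟩
    obtain ⟨ν, hν, ε, hε, H⟩ := hV f hf
    exact ⟨ν, hν, ε, hε, fun g hg => hVU (H g hg)⟩
  · rintro ⟨ν, hν, ε, hε, H⟩
    refine ⟨{g | ν |g - f| < ε}, fun g hg => H g hg, ?_, by simpa using hε⟩
    intro g hg
    refine ⟨ν, hν, ε - ν |g - f|, sub_pos.2 hg, fun k hk => ?_⟩
    have := hν.mono (abs_sub_le_add f g k)
    rw [map_add] at this
    change ν |k - f| < ε
    linarith

theorem mem_nhds_uawTopology {U : Set F} {f : F} :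
    U ∈ @nhds F (uawTopology F) f ↔ ∃ h : F, 0 ≤ h ∧ ∃ ν : StrongDual ℝ F, PosFunctional F ν ∧
      ∃ ε : ℝ, 0 < ε ∧ ∀ g, ν (h ⊓ |g - f|) < ε → g ∈ U := by
  rw [@_root_.mem_nhds_iff F (uawTopology F) f U]
  constructor
  · rintro ⟨V, hVU, hV, hf⟩
    obtain ⟨h, hh, ν, hν, ε, hε, H⟩ := hV f hf
    exact ⟨h, hh, ν, hν, ε, hε, fun g hg => hVU (H g hg)⟩
  · rintro ⟨h, hh, ν, hν, ε, hε, H⟩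
    refine ⟨{g | ν (h ⊓ |g - f|) < ε}, fun g hg => H g hg, ?_, by simpa [hh] using hε⟩
    intro g hg
    refine ⟨h, hh, ν, hν, ε - ν (h ⊓ |g - f|), sub_pos.2 hg, fun k hk => ?_⟩
    have := hν.mono ((inf_le_inf_left h (abs_sub_le_add f g k)).trans
      (inf_add_le_add h _ _ hh (abs_nonneg _) (abs_nonneg _)))
    rw [map_add] at this
    change ν (h ⊓ |k - f|) < ε
    linarith

end Topologies

section OrderContinuity

variable {F : Type*} [AddCommGroup F] [Lattice F]

/-- A filter on `F` is order null if some decreasing net with infimum zero (given by its range, a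
nonempty downward directed set `D` with `inf D = 0`) eventually dominates the absolute value. For
the tail filter of a net this is order convergence of the net to zero. -/
def OrderNull (l : Filter F) : Prop :=
  ∃ D : Set F, D.Nonempty ∧ DirectedOn (· ≥ ·) D ∧ IsGLB D 0 ∧ ∀ d ∈ D, ∀ᶠ f in l, |f| ≤ d

/-- A linear topology is order continuous if every order null net is null. -/
def OrderContinuousTopology (t : TopologicalSpace F) : Prop :=
  ∀ l : Filter F, OrderNull l → l ≤ @nhds F t 0

/-- `t` is a Hausdorff order continuous locally solid (linear) topology on the vector lattice
`F`. -/
structure IsHausdorffOrderContinuousLocallySolid [Module ℝ F] (t : TopologicalSpace F) : Prop where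
  isTopologicalAddGroup : @IsTopologicalAddGroup F t _
  continuousSMul : @ContinuousSMul ℝ F _ _ t
  t2Space : @T2Space F t
  locallySolid : ∀ U ∈ @nhds F t 0, ∃ V ∈ @nhds F t 0,
    LatticeOrderedAddCommGroup.IsSolid V ∧ V ⊆ U
  orderContinuous : OrderContinuousTopology t

/-- `t` is `τ_F`, the weakest Hausdorff order continuous locally solid topology on `F`. (In Mathlib
`s ≤ t` means that the topology `t` is weaker than `s`.) -/
def IsTauF [Module ℝ F] (t : TopologicalSpace F) : Prop :=
  IsGreatest {s : TopologicalSpace F | IsHausdorffOrderContinuousLocallySolid s} t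

end OrderContinuity

section BanachSpaces

/-- Weak convergence of a sequence to zero. -/
def WeaklyNull {X : Type*} [NormedAddCommGroup X] [NormedSpace ℝ X] (u : ℕ → X) : Prop :=
  Tendsto (fun n => toWeakSpace ℝ X (u n)) atTop (𝓝 0)

/-- A normed space is reflexive if its canonical embedding into the bidual is onto. -/
def Reflexive (X : Type*) [NormedAddCommGroup X] [NormedSpace ℝ X] : Prop :=
  Function.Surjective (NormedSpace.inclusionInDoubleDual ℝ X)

variable {X H : Type*} [NormedAddCommGroup X] [NormedSpace ℝ X] [NormedAddCommGroup H]
  [NormedSpace ℝ H]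

/-- `T` is tauberian if `(T**)⁻¹(H) ⊆ X`; here `precomp ℝ T : H* → X*` is the adjoint of `T`, and
`φ ∘ T*` is `T** φ`. -/
def Tauberian (T : X →L[ℝ] H) : Prop :=
  ∀ φ : StrongDual ℝ (StrongDual ℝ X),
    φ.comp (ContinuousLinearMap.precomp ℝ T) ∈ Set.range (NormedSpace.inclusionInDoubleDual ℝ H) →
      φ ∈ Set.range (NormedSpace.inclusionInDoubleDual ℝ X)

/-- `T` is strictly singular if it is not bounded below on any infinite dimensional subspace. -/
def StrictlySingular (T : X →L[ℝ] H) : Prop :=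
  ∀ E : Submodule ℝ X, ¬ FiniteDimensional ℝ E → ¬ ∃ c : ℝ, 0 < c ∧ ∀ x ∈ E, c * ‖x‖ ≤ ‖T x‖

end BanachSpaces

section Lattices

variable {F : Type*} [NormedAddCommGroup F] [Lattice F]

/-- A disjoint sequence. -/
def DisjointSeq (f : ℕ → F) : Prop := ∀ m n, m ≠ n → |f m| ⊓ |f n| = 0

/-- An almost disjoint sequence: normalized and asymptotic in norm to a disjoint sequence. -/
def AlmostDisjointSeq (e : ℕ → F) : Prop :=
  (∀ n, ‖e n‖ = 1) ∧
    ∃ f : ℕ → F, DisjointSeq f ∧ Tendsto (fun n => ‖f n - e n‖) atTop (𝓝 0)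

variable (F) in
/-- The norm of `F` is order continuous. -/
def OrderContinuous : Prop := OrderContinuousTopology (inferInstance : TopologicalSpace F)

variable [NormedSpace ℝ F]

variable (F) in
/-- The positive Schur property: positive weakly null sequences are norm null. -/
def PositiveSchur : Prop :=
  ∀ u : ℕ → F, (∀ n, 0 ≤ u n) → WeaklyNull u → Tendsto (fun n => ‖u n‖) atTop (𝓝 0)

/-- A subspace is dispersed if it contains no almost disjoint sequence. -/
def Dispersed (E : Submodule ℝ F) : Prop :=
  ¬ ∃ e : ℕ → F, (∀ n, e n ∈ E) ∧ AlmostDisjointSeq e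

/-- `T` is disjointly non-singular if its restriction to the span of any disjoint sequence (of
nonzero vectors) is not strictly singular. -/
def DisjointlyNonSingular {H : Type*} [NormedAddCommGroup H] [NormedSpace ℝ H] (T : F →L[ℝ] H) :
    Prop :=
  ∀ f : ℕ → F, DisjointSeq f → (∀ n, f n ≠ 0) →
    ¬ StrictlySingular (T.comp (Submodule.span ℝ (Set.range f)).subtypeL)

end Lattices

end BanachLattice

/-! The proof rests on sign functionals. Let `ν ≥ 0` and let `(d k)` be disjoint. Restricting `ν` to
the bands generated by the positive and negative parts of `d k` and subtracting gives `σ k` with `σ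
k (d k) = ν |d k|` and `σ k (d j) = 0` for `j ≠ k`. Disjointness bounds the sum of the `|σ k|` by
`ν`, so `φ = ∑ σ k` converges pointwise on `F` (`exists_sign_functional`).

Equivalences. Every functional is a difference of positive ones, so aw-convergence of `u n` to `f`
says that `|u n - f|` is weakly null; this gives (i) ⇔ (ii). A positive weakly null sequence is
uaw-null because `h ⊓ u ≤ u`; this gives (iv) ⇒ (i). For (i) ⇒ (iii), a weakly null and uaw-null
sequence is shown to be aw-null (`WeaklyNull.tendsto_posFunctional_abs`): otherwise a subsequence
is, up to a `ν`-small error, disjoint with `ν |w k|` bounded away from zero, and a sign functional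
contradicts weak nullity. The positive Schur property also forces an order continuous norm, since
the steps of a decreasing positive sequence are weakly null. With such a norm the uaw-topology is
`τ_F` (`isTauF_uawTopology`), by an Amemiya-type argument: every competing topology is at least as
fine as the norm on order intervals. Uniqueness of `τ_F` gives (iii) ⇒ (iv).

Consequences. Suppose a disjoint sequence `b` with `ν |b n| ≥ ε` along an ultrafilter converges
weakly along it to some `x` in `F`. Each `σ k` vanishes at `x`, so `φ x = ∑ σ k x = 0`, while `φ x =
lim ν |b n| ≥ ε`. Hence its weak-star limits lie in the bidual outside `F`
(`PositiveSchur.exists_ultrafilter`), which both reflexivity and the tauberian property forbid. -/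

namespace BanachLattice

/-! ### Disjointness in lattice ordered groups -/

section LatticeGroups

variable {G : Type*} [AddCommGroup G] [Lattice G] [IsOrderedAddMonoid G]

theorem inf_add_le_inf_add_inf {h a b : G} (hh : 0 ≤ h) (ha : 0 ≤ a) (hb : 0 ≤ b) :
    h ⊓ (a + b) ≤ h ⊓ a + h ⊓ b := by
  rw [add_inf, inf_add, inf_add]
  exact le_inf (le_inf (inf_le_left.trans (le_add_of_nonneg_right hh))
    (inf_le_left.trans (le_add_of_nonneg_left ha)))
    (le_inf (inf_le_left.trans (le_add_of_nonneg_right hb)) inf_le_right)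

theorem inf_add_inf_le_inf_add {f g p q : G} : f ⊓ p + g ⊓ q ≤ (f + g) ⊓ (p + q) :=
  le_inf (add_le_add inf_le_left inf_le_left) (add_le_add inf_le_right inf_le_right)

omit [IsOrderedAddMonoid G] in
theorem inf_eq_zero_of_le {a b a' b' : G} (h : a ⊓ b = 0) (ha : 0 ≤ a') (hb : 0 ≤ b')
    (haa : a' ≤ a) (hbb : b' ≤ b) : a' ⊓ b' = 0 :=
  le_antisymm (h ▸ inf_le_inf haa hbb) (le_inf ha hb)

theorem inf_add_eq_zero {a b c : G} (hc : 0 ≤ c) (ha : 0 ≤ a) (hb : 0 ≤ b) (hca : c ⊓ a = 0)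
    (hcb : c ⊓ b = 0) : c ⊓ (a + b) = 0 :=
  le_antisymm ((inf_add_le_inf_add_inf hc ha hb).trans (by rw [hca, hcb, add_zero]))
    (le_inf hc (add_nonneg ha hb))

theorem inf_nsmul_eq_zero {a b : G} (ha : 0 ≤ a) (hb : 0 ≤ b) (h : a ⊓ b = 0) (n : ℕ) :
    a ⊓ n • b = 0 := by
  induction n with
  | zero => simpa using ha
  | succ n ih =>
    rw [succ_nsmul]
    exact inf_add_eq_zero ha (nsmul_nonneg hb n) hb ih h

theorem inf_sum_eq_zero {ι : Type*} {g : ι → G} {c : G} (hc : 0 ≤ c) (s : Finset ι)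
    (hg : ∀ i ∈ s, 0 ≤ g i) (h : ∀ i ∈ s, c ⊓ g i = 0) : c ⊓ ∑ i ∈ s, g i = 0 := by
  classical
  induction s using Finset.induction_on with
  | empty => simpa using hc
  | insert a s ha ih =>
    rw [Finset.sum_insert ha]
    exact inf_add_eq_zero hc (hg a (by simp))
      (Finset.sum_nonneg fun i hi => hg i (Finset.mem_insert_of_mem hi)) (h a (by simp))
      (ih (fun i hi => hg i (Finset.mem_insert_of_mem hi))
        fun i hi => h i (Finset.mem_insert_of_mem hi))

theorem add_le_of_inf_eq_zero {a b f : G} (h : a ⊓ b = 0) (ha : a ≤ f) (hb : b ≤ f) :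
    a + b ≤ f := by
  rw [← inf_add_sup, h, zero_add]
  exact sup_le ha hb

theorem sum_le_of_pairwise_inf_eq_zero {ι : Type*} {g : ι → G} {f : G} (hf : 0 ≤ f)
    (s : Finset ι) (hg : ∀ i, 0 ≤ g i) (hgf : ∀ i, g i ≤ f)
    (h : ∀ i j, i ≠ j → g i ⊓ g j = 0) : ∑ i ∈ s, g i ≤ f := by
  classical
  induction s using Finset.induction_on with
  | empty => simpa using hf
  | insert a s ha ih =>
    rw [Finset.sum_insert ha]
    refine add_le_of_inf_eq_zero (inf_sum_eq_zero (hg a) s (fun i _ => hg i) fun i hi => ?_)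
      (hgf a) ih
    exact h a i (by rintro rfl; exact ha hi)

theorem posPart_le_abs (f : G) : f⁺ ≤ |f| :=
  (le_add_of_nonneg_right (negPart_nonneg f)).trans_eq (posPart_add_negPart f)

theorem negPart_le_abs (f : G) : f⁻ ≤ |f| :=
  (le_add_of_nonneg_left (posPart_nonneg f)).trans_eq (posPart_add_negPart f)

end LatticeGroups

/-! ### Positive functionals and sign functionals -/

section Functionals

variable {F : Type*} [NormedAddCommGroup F] [Lattice F] [IsOrderedAddMonoid F]
  [HasSolidNorm F] [NormedSpace ℝ F] [IsOrderedModule ℝ F]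

omit [NormedSpace ℝ F] [IsOrderedModule ℝ F] in
theorem norm_le_norm_of_le {f g : F} (hf : 0 ≤ f) (h : f ≤ g) : ‖f‖ ≤ ‖g‖ :=
  norm_le_norm_of_abs_le_abs (by rwa [abs_of_nonneg hf, abs_of_nonneg (hf.trans h)])

omit [HasSolidNorm F] [IsOrderedModule ℝ F] in
theorem PosFunctional.abs_apply_le {ν : StrongDual ℝ F} (hν : PosFunctional F ν) (f : F) :
    |ν f| ≤ ν |f| := by
  rw [abs_le]
  constructor
  · have := hν.mono (neg_le_abs f)
    rw [map_neg] at this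
    linarith
  · exact hν.mono (le_abs_self f)

omit [IsOrderedModule ℝ F] in
/-- An additive bounded nonnegative function on the positive cone extends to a positive
functional. -/
theorem exists_posFunctional_of_additive (m : F → ℝ) (C : ℝ)
    (hadd : ∀ f g, 0 ≤ f → 0 ≤ g → m (f + g) = m f + m g) (hpos : ∀ f, 0 ≤ f → 0 ≤ m f)
    (hb : ∀ f, 0 ≤ f → m f ≤ C * ‖f‖) :
    ∃ μ : StrongDual ℝ F, PosFunctional F μ ∧ ∀ f, 0 ≤ f → μ f = m f := by
  have h0 : m 0 = 0 := by simpa using hadd 0 0 le_rfl le_rfl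
  let A : F →+ ℝ := AddMonoidHom.mk' (fun f => m f⁺ - m f⁻) (by
    intro f g
    -- Rearranged so that only positive elements occur, where `m` is additive.
    have key : (f + g)⁺ + (f⁻ + g⁻) = f⁺ + g⁺ + (f + g)⁻ := by
      rw [← sub_eq_zero]
      have h1 := posPart_sub_negPart f
      have h2 := posPart_sub_negPart g
      have h3 := posPart_sub_negPart (f + g)
      calc _ = ((f + g)⁺ - (f + g)⁻) - (f⁺ - f⁻) - (g⁺ - g⁻) := by abel
        _ = 0 := by rw [h1, h2, h3]; abel
    have := congrArg m key
    rw [hadd _ _ (posPart_nonneg _) (add_nonneg (negPart_nonneg _) (negPart_nonneg _)),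
      hadd _ _ (negPart_nonneg _) (negPart_nonneg _),
      hadd _ _ (add_nonneg (posPart_nonneg _) (posPart_nonneg _)) (negPart_nonneg _),
      hadd _ _ (posPart_nonneg _) (posPart_nonneg _)] at this
    linarith)
  have hA : ∀ f, A f = m f⁺ - m f⁻ := fun f => rfl
  -- Homogeneity comes for free: a continuous additive map is real linear.
  have hc : Continuous A := AddMonoidHomClass.continuous_of_bound A C (by
    intro f
    have h1 := hpos _ (posPart_nonneg f)
    have h2 := hpos _ (negPart_nonneg f)
    have h3 := hb _ (abs_nonneg f)
    rw [← posPart_add_negPart, hadd _ _ (posPart_nonneg _) (negPart_nonneg _),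
      posPart_add_negPart, norm_abs_eq_norm] at h3
    rw [hA, Real.norm_eq_abs, abs_le]
    constructor <;> linarith)
  have hm : ∀ f, 0 ≤ f → A.toRealLinearMap hc f = m f := by
    intro f hf
    change A f = m f
    rw [hA, posPart_of_nonneg hf, negPart_of_nonneg hf, h0, sub_zero]
  exact ⟨A.toRealLinearMap hc, fun f hf => (hpos f hf).trans_eq (hm f hf).symm, hm⟩

omit [IsOrderedModule ℝ F] in
/-- Every functional is dominated on the positive cone by a positive one. -/
theorem exists_posFunctional_ge (φ : StrongDual ℝ F) :
    ∃ μ : StrongDual ℝ F, PosFunctional F μ ∧ ∀ f, 0 ≤ f → φ f ≤ μ f := by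
  have hne : ∀ f : F, 0 ≤ f → (0 : ℝ) ∈ φ '' Set.Icc 0 f := fun f hf =>
    ⟨0, ⟨le_rfl, hf⟩, map_zero φ⟩
  have hbd : ∀ f : F, ‖φ‖ * ‖f‖ ∈ upperBounds (φ '' Set.Icc 0 f) := by
    rintro f _ ⟨g, hg, rfl⟩
    exact (le_abs_self _).trans ((φ.le_opNorm g).trans
      (mul_le_mul_of_nonneg_left (norm_le_norm_of_le hg.1 hg.2) (norm_nonneg _)))
  -- Riesz–Kantorovich formula for the positive part of `φ`; its additivity is the Riesz
  -- decomposition of `[0, f + g]`.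
  obtain ⟨μ, hμ, h⟩ := exists_posFunctional_of_additive (fun f : F => sSup (φ '' Set.Icc 0 f)) ‖φ‖
    (fun f g hf hg => by
      apply le_antisymm
      · refine csSup_le ⟨0, hne _ (add_nonneg hf hg)⟩ ?_
        rintro _ ⟨k, hk, rfl⟩
        have e : φ k = φ (k ⊓ f) + φ (k - k ⊓ f) := by rw [← map_add]; congr 1; abel
        rw [e]
        refine add_le_add (le_csSup ⟨_, hbd f⟩ ⟨_, ⟨le_inf hk.1 hf, inf_le_right⟩, rfl⟩)
          (le_csSup ⟨_, hbd g⟩ ⟨_, ⟨sub_nonneg.2 inf_le_left, ?_⟩, rfl⟩)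
        rw [sub_inf, sub_self]
        exact sup_le hg (sub_le_iff_le_add'.2 hk.2)
      · rw [← le_sub_iff_add_le]
        refine csSup_le ⟨0, hne _ hf⟩ ?_
        rintro _ ⟨a, ha, rfl⟩
        rw [le_sub_comm]
        refine csSup_le ⟨0, hne _ hg⟩ ?_
        rintro _ ⟨b, hb, rfl⟩
        rw [le_sub_iff_add_le', ← map_add]
        exact le_csSup ⟨_, hbd _⟩ ⟨_, ⟨add_nonneg ha.1 hb.1, add_le_add ha.2 hb.2⟩, rfl⟩)
    (fun f hf => le_csSup ⟨_, hbd f⟩ (hne f hf))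
    (fun f hf => csSup_le ⟨0, hne f hf⟩ (hbd f))
  exact ⟨μ, hμ, fun f hf => (h f hf).symm ▸ le_csSup ⟨_, hbd f⟩ ⟨f, ⟨hf, le_rfl⟩, rfl⟩⟩

omit [IsOrderedModule ℝ F] in
/-- Every functional is a difference of positive functionals. -/
theorem exists_posFunctional_sub (φ : StrongDual ℝ F) :
    ∃ μ ρ : StrongDual ℝ F, PosFunctional F μ ∧ PosFunctional F ρ ∧ φ = μ - ρ := by
  obtain ⟨μ, hμ, h⟩ := exists_posFunctional_ge φ
  exact ⟨μ, μ - φ, hμ, fun f hf => sub_nonneg.2 (h f hf), by abel⟩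

omit [IsOrderedModule ℝ F] in
/-- The restriction of a positive functional to the band generated by `p`. -/
theorem exists_posFunctional_tendsto_inf_nsmul {ν : StrongDual ℝ F} (hν : PosFunctional F ν)
    {p : F} (hp : 0 ≤ p) : ∃ μ : StrongDual ℝ F, PosFunctional F μ ∧
      ∀ f, 0 ≤ f → Tendsto (fun n : ℕ => ν (f ⊓ n • p)) atTop (𝓝 (μ f)) := by
  have hmono : ∀ f : F, Monotone (fun n : ℕ => ν (f ⊓ n • p)) := fun f a b hab =>
    hν.mono (inf_le_inf_left f (nsmul_le_nsmul_left hp hab))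
  have hlim : ∀ f : F, Tendsto (fun n : ℕ => ν (f ⊓ n • p)) atTop (𝓝 (⨆ n : ℕ, ν (f ⊓ n • p))) :=
    fun f => tendsto_atTop_ciSup (hmono f)
      ⟨ν f, by rintro _ ⟨n, rfl⟩; exact hν.mono inf_le_left⟩
  obtain ⟨μ, hμ, h⟩ := exists_posFunctional_of_additive (fun f : F => ⨆ n : ℕ, ν (f ⊓ n • p)) ‖ν‖
    (fun f g hf hg => by
      apply le_antisymm
      · refine le_of_tendsto_of_tendsto' (hlim _) ((hlim f).add (hlim g)) fun n => ?_
        rw [← map_add]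
        refine hν.mono ?_
        rw [inf_comm, inf_comm f, inf_comm g]
        exact inf_add_le_inf_add_inf (nsmul_nonneg hp n) hf hg
      -- Superadditivity costs a factor two, `f ⊓ n • p + g ⊓ n • p ≤ (f + g) ⊓ (n + n) • p`,
      -- harmless in the limit.
      · refine le_of_tendsto_of_tendsto' ((hlim f).add (hlim g))
          ((hlim (f + g)).comp (tendsto_id.atTop_add_atTop tendsto_id)) fun n => ?_
        rw [← map_add]
        refine hν.mono ?_
        simp only [id, add_nsmul]
        exact inf_add_inf_le_inf_add)
    (fun f hf => ge_of_tendsto' (hlim f) fun n => hν _ (le_inf hf (nsmul_nonneg hp n)))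
    (fun f hf => le_of_tendsto' (hlim f) fun n => (hν.mono inf_le_left).trans
      ((le_abs_self _).trans (ν.le_opNorm f)))
  exact ⟨μ, hμ, fun f hf => (h f hf).symm ▸ hlim f⟩

omit [IsOrderedModule ℝ F] in
/-- For a disjoint sequence `d` and a positive functional `ν` there is a functional `φ` dominated
by `ν` which attains `ν |d k|` at every `d k`, and which splits as a sum of functionals, the `k`-th
of which vanishes at all terms but `d k`. -/
theorem exists_sign_functional {ν : StrongDual ℝ F} (hν : PosFunctional F ν) {d : ℕ → F}
    (hd : DisjointSeq d) : ∃ (σ : ℕ → StrongDual ℝ F) (φ : StrongDual ℝ F),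
      (∀ f, φ f = ∑' k, σ k f) ∧ (∀ f, |φ f| ≤ ν |f|) ∧ (∀ k, φ (d k) = ν |d k|) ∧
      ∀ j k, j ≠ k → σ k (d j) = 0 := by
  choose μ hμ hμl using fun k => exists_posFunctional_tendsto_inf_nsmul hν (posPart_nonneg (d k))
  choose ρ hρ hρl using fun k => exists_posFunctional_tendsto_inf_nsmul hν (negPart_nonneg (d k))
  have hself : ∀ (p : F) (x : ℝ), 0 ≤ p → Tendsto (fun n : ℕ => ν (p ⊓ n • p)) atTop (𝓝 x) →
      x = ν p := by
    intro p x hp h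
    refine tendsto_nhds_unique h (tendsto_const_nhds.congr' ?_)
    filter_upwards [eventually_ge_atTop 1] with n hn
    rw [inf_eq_left.2]
    simpa using nsmul_le_nsmul_left hp hn
  have hdisj : ∀ (p q : F) (x : ℝ), 0 ≤ p → 0 ≤ q → p ⊓ q = 0 →
      Tendsto (fun n : ℕ => ν (p ⊓ n • q)) atTop (𝓝 x) → x = 0 := by
    intro p q x hp hq hpq h
    refine tendsto_nhds_unique h (tendsto_const_nhds.congr fun n => ?_)
    rw [inf_nsmul_eq_zero hp hq hpq, map_zero]
  -- `τ k` is the restriction of `ν` to the band of `d k`; `σ k` carries the signs of `d k` and is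
  -- dominated by `τ k`.
  let τ : ℕ → StrongDual ℝ F := fun k => μ k + ρ k
  let σ : ℕ → StrongDual ℝ F := fun k => μ k - ρ k
  have hτσ : ∀ k f, |σ k f| ≤ τ k |f| := fun k f =>
    (abs_sub _ _).trans (add_le_add ((hμ k).abs_apply_le f) ((hρ k).abs_apply_le f))
  -- Before the limit in `n`, the pieces `f ⊓ n • |d k|` are disjoint minorants of `f`, so their sum
  -- stays below `f`.
  have hτ : ∀ f, 0 ≤ f → ∀ s : Finset ℕ, ∑ k ∈ s, τ k f ≤ ν f := by
    intro f hf s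
    refine le_of_tendsto'
      (tendsto_finsetSum s fun k _ => (hμl k f hf).add (hρl k f hf)) fun n => ?_
    simp only [← map_add, ← map_sum]
    refine hν.mono ((Finset.sum_le_sum (g := fun k => f ⊓ n • |d k|) fun k _ => ?_).trans
      (sum_le_of_pairwise_inf_eq_zero hf s
        (fun k => le_inf hf (nsmul_nonneg (abs_nonneg _) n)) (fun k => inf_le_left)
        fun i j hij => ?_))
    · refine add_le_of_inf_eq_zero (inf_eq_zero_of_le (a := n • (d k)⁺) (b := n • (d k)⁻) ?_
        (le_inf hf (nsmul_nonneg (posPart_nonneg _) n))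
        (le_inf hf (nsmul_nonneg (negPart_nonneg _) n)) inf_le_right inf_le_right)
        (inf_le_inf_left f (nsmul_le_nsmul_right (posPart_le_abs _) n))
        (inf_le_inf_left f (nsmul_le_nsmul_right (negPart_le_abs _) n))
      apply inf_nsmul_eq_zero (nsmul_nonneg (posPart_nonneg _) n) (negPart_nonneg _)
      rw [inf_comm]
      apply inf_nsmul_eq_zero (negPart_nonneg _) (posPart_nonneg _)
      rw [inf_comm, posPart_inf_negPart_eq_zero]
    · refine inf_eq_zero_of_le (a := n • |d i|) (b := n • |d j|) ?_
        (le_inf hf (nsmul_nonneg (abs_nonneg _) n)) (le_inf hf (nsmul_nonneg (abs_nonneg _) n))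
        inf_le_right inf_le_right
      apply inf_nsmul_eq_zero (nsmul_nonneg (abs_nonneg _) n) (abs_nonneg _)
      rw [inf_comm]
      apply inf_nsmul_eq_zero (abs_nonneg _) (abs_nonneg _)
      rw [inf_comm, hd i j hij]
  have hτ0 : ∀ f k, 0 ≤ τ k |f| := fun f k =>
    add_nonneg (hμ k _ (abs_nonneg f)) (hρ k _ (abs_nonneg f))
  have hτs : ∀ f : F, Summable fun k => τ k |f| := fun f =>
    summable_of_sum_le (hτ0 f) (hτ _ (abs_nonneg f))
  have hσs : ∀ f : F, Summable fun k => |σ k f| := fun f =>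
    (hτs f).of_nonneg_of_le (fun _ => abs_nonneg _) fun k => hτσ k f
  have hbound : ∀ f : F, |∑' k, σ k f| ≤ ν |f| := fun f =>
    calc |∑' k, σ k f| ≤ ∑' k, |σ k f| := by
          simpa only [Real.norm_eq_abs] using norm_tsum_le_tsum_norm (f := fun k => σ k f) (hσs f)
      _ ≤ ∑' k, τ k |f| := (hσs f).tsum_le_tsum (fun k => hτσ k f) (hτs f)
      _ ≤ ν |f| := Real.tsum_le_of_sum_le (hτ0 f) (hτ _ (abs_nonneg f))
  let φ : F →ₗ[ℝ] ℝ :=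
    { toFun := fun f => ∑' k, σ k f
      map_add' := fun f g => by
        simp only [map_add]
        exact (hσs f).of_abs.tsum_add (hσs g).of_abs
      map_smul' := fun c f => by
        simp only [map_smul, smul_eq_mul, tsum_mul_left, RingHom.id_apply] }
  have hzero : ∀ j k, j ≠ k → σ k (d j) = 0 := by
    intro j k hjk
    have hP : ∀ x, 0 ≤ x → x ≤ |d j| → μ k x = 0 := fun x hx hxd =>
      hdisj x _ _ hx (posPart_nonneg _)
        (inf_eq_zero_of_le (hd j k hjk) hx (posPart_nonneg _) hxd (posPart_le_abs _)) (hμl k x hx)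
    have hN : ∀ x, 0 ≤ x → x ≤ |d j| → ρ k x = 0 := fun x hx hxd =>
      hdisj x _ _ hx (negPart_nonneg _)
        (inf_eq_zero_of_le (hd j k hjk) hx (negPart_nonneg _) hxd (negPart_le_abs _)) (hρl k x hx)
    change μ k (d j) - ρ k (d j) = 0
    rw [← posPart_sub_negPart (d j), map_sub, map_sub, hP _ (posPart_nonneg _) (posPart_le_abs _),
      hP _ (negPart_nonneg _) (negPart_le_abs _), hN _ (posPart_nonneg _) (posPart_le_abs _),
      hN _ (negPart_nonneg _) (negPart_le_abs _)]
    simp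
  have hdiag : ∀ k, σ k (d k) = ν |d k| := by
    intro k
    have h1 := hself _ _ (posPart_nonneg (d k)) (hμl k _ (posPart_nonneg _))
    have h2 := hself _ _ (negPart_nonneg (d k)) (hρl k _ (negPart_nonneg _))
    have h3 := hdisj _ _ _ (negPart_nonneg (d k)) (posPart_nonneg (d k))
      (by rw [inf_comm, posPart_inf_negPart_eq_zero]) (hμl k _ (negPart_nonneg _))
    have h4 := hdisj _ _ _ (posPart_nonneg (d k)) (negPart_nonneg (d k))
      (posPart_inf_negPart_eq_zero _) (hρl k _ (posPart_nonneg _))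
    change μ k (d k) - ρ k (d k) = _
    have e : ∀ ψ : StrongDual ℝ F, ψ (d k) = ψ (d k)⁺ - ψ (d k)⁻ := fun ψ => by
      rw [← map_sub, posPart_sub_negPart]
    rw [e, e, ← posPart_add_negPart, map_add, h1, h2, h3, h4]
    ring
  refine ⟨σ, φ.mkContinuous ‖ν‖ fun f => (hbound f).trans ?_, fun f => rfl, hbound, fun k => ?_,
    hzero⟩
  · simpa only [norm_abs_eq_norm] using (le_abs_self _).trans (ν.le_opNorm |f|)
  · change ∑' i, σ i (d k) = _
    rw [tsum_eq_single k fun i hi => hzero k i hi.symm, hdiag]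

end Functionals

/-! ### Weak convergence and the bidual -/

section WeakConvergence

variable {X : Type*} [NormedAddCommGroup X] [NormedSpace ℝ X]

theorem weaklyNull_iff {u : ℕ → X} :
    WeaklyNull u ↔ ∀ φ : StrongDual ℝ X, Tendsto (fun n => φ (u n)) atTop (𝓝 0) := by
  have hinj : Function.Injective (topDualPairing ℝ X).flip := by
    intro x y h
    refine (SeparatingDual.eq_iff_forall_dual_eq (R := ℝ)).2 fun g => ?_
    exact DFunLike.congr_fun h g
  refine (WeakBilin.tendsto_iff_forall_eval_tendsto (topDualPairing ℝ X).flip hinj).trans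
    (forall_congr' fun φ => ?_)
  change Tendsto (fun n => φ (u n)) atTop (𝓝 (φ 0)) ↔ _
  rw [map_zero]

/-- Along an ultrafilter a bounded sequence converges weak-star to an element of the bidual. -/
theorem exists_bidual_tendsto {u : ℕ → X} {C : ℝ} (hu : ∀ n, ‖u n‖ ≤ C) (𝒰 : Ultrafilter ℕ) :
    ∃ Φ : StrongDual ℝ (StrongDual ℝ X),
      ∀ φ : StrongDual ℝ X, Tendsto (fun n => φ (u n)) 𝒰 (𝓝 (Φ φ)) := by
  have hb : ∀ (φ : StrongDual ℝ X) n, ‖φ (u n)‖ ≤ C * ‖φ‖ := fun φ n =>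
    (φ.le_opNorm _).trans (by
      rw [mul_comm]; exact mul_le_mul_of_nonneg_right (hu n) (norm_nonneg _))
  have hlim : ∀ φ : StrongDual ℝ X, ∃ y, Tendsto (fun n => φ (u n)) 𝒰 (𝓝 y) := by
    intro φ
    obtain ⟨y, -, hy⟩ := (isCompact_closedBall (0 : ℝ) (C * ‖φ‖)).ultrafilter_le_nhds
      (𝒰.map fun n => φ (u n)) (by
        rw [le_principal_iff]
        exact Filter.mem_map.2 (Filter.univ_mem' fun n => by
          simpa using hb φ n))
    exact ⟨y, hy⟩
  choose L hL using hlim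
  let Φ : StrongDual ℝ X →ₗ[ℝ] ℝ :=
    { toFun := L
      map_add' := fun φ ψ => tendsto_nhds_unique (hL (φ + ψ)) ((hL φ).add (hL ψ))
      map_smul' := fun c φ => tendsto_nhds_unique (hL (c • φ)) ((hL φ).const_mul c) }
  exact ⟨Φ.mkContinuous C fun φ => le_of_tendsto (hL φ).norm (Eventually.of_forall (hb φ)), hL⟩

/-- Uniform boundedness principle on the dual, which is complete even if `X` is not. -/
theorem WeaklyNull.exists_norm_le {u : ℕ → X} (hu : WeaklyNull u) : ∃ C, ∀ n, ‖u n‖ ≤ C := by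
  rw [weaklyNull_iff] at hu
  obtain ⟨C, hC⟩ := banach_steinhaus (g := fun n => NormedSpace.inclusionInDoubleDual ℝ X (u n))
    fun φ => by
      obtain ⟨c, hc⟩ := (hu φ).norm.bddAbove_range
      exact ⟨c, fun n => hc ⟨n, rfl⟩⟩
  refine ⟨C, fun n => ?_⟩
  rw [← (NormedSpace.inclusionInDoubleDualLi (𝕜 := ℝ) (E := X)).norm_map]
  exact hC n

end WeakConvergence

/-! ### Disjoint sequences, reflexivity and tauberian operators -/

section PositiveSchurProperty

variable {F : Type*} [NormedAddCommGroup F] [Lattice F] [IsOrderedAddMonoid F]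
  [HasSolidNorm F] [NormedSpace ℝ F] [IsOrderedModule ℝ F]

omit [IsOrderedModule ℝ F] in
theorem weaklyNull_of_forall_posFunctional {u : ℕ → F}
    (h : ∀ ν : StrongDual ℝ F, PosFunctional F ν → Tendsto (fun n => ν (u n)) atTop (𝓝 0)) :
    WeaklyNull u := by
  rw [weaklyNull_iff]
  intro φ
  obtain ⟨μ, ρ, hμ, hρ, rfl⟩ := exists_posFunctional_sub φ
  simpa using (h μ hμ).sub (h ρ hρ)

omit [IsOrderedModule ℝ F] in
theorem PositiveSchur.tendsto_norm (hF : PositiveSchur F) {u : ℕ → F}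
    (h : ∀ ν : StrongDual ℝ F, PosFunctional F ν → Tendsto (fun n => ν |u n|) atTop (𝓝 0)) :
    Tendsto (fun n => ‖u n‖) atTop (𝓝 0) := by
  simpa only [norm_abs_eq_norm] using
    hF (fun n => |u n|) (fun n => abs_nonneg _) (weaklyNull_of_forall_posFunctional h)

omit [NormedSpace ℝ F] [IsOrderedModule ℝ F] in
theorem abs_ne_zero_of_ne_zero {f : F} (hf : f ≠ 0) : |f| ≠ 0 := by
  rwa [← norm_ne_zero_iff, norm_abs_eq_norm, norm_ne_zero_iff]

omit [IsOrderedModule ℝ F] in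
theorem exists_posFunctional_pos {f : F} (hf : 0 ≤ f) (hf0 : f ≠ 0) :
    ∃ ν : StrongDual ℝ F, PosFunctional F ν ∧ 0 < ν f := by
  obtain ⟨φ, -, hφ⟩ := exists_dual_vector ℝ f (by simpa using hf0)
  obtain ⟨μ, hμ, h⟩ := exists_posFunctional_ge φ
  refine ⟨μ, hμ, lt_of_lt_of_le ?_ (h f hf)⟩
  rw [hφ]
  simpa using hf0

theorem frequently_le_of_not_tendsto_zero {a : ℕ → ℝ} (h0 : ∀ n, 0 ≤ a n)
    (h : ¬ Tendsto a atTop (𝓝 0)) : ∃ ε > 0, ∃ᶠ n in atTop, ε ≤ a n := by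
  contrapose! h
  rw [Metric.tendsto_nhds]
  intro ε hε
  have := h ε hε
  filter_upwards [this] with n hn
  rw [Real.dist_eq, sub_zero, abs_of_nonneg (h0 n)]
  exact hn

omit [IsOrderedModule ℝ F] in
/-- In the presence of the positive Schur property, a disjoint sequence which is not norm null has
a weak-star cluster point in the bidual outside the space. -/
theorem PositiveSchur.exists_ultrafilter (hF : PositiveSchur F) {b : ℕ → F} (hb : DisjointSeq b)
    (hn : ¬ Tendsto (fun n => ‖b n‖) atTop (𝓝 0)) :
    ∃ 𝒰 : Ultrafilter ℕ, (𝒰 : Filter ℕ) ≤ atTop ∧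
      ∀ x : F, ¬ ∀ φ : StrongDual ℝ F, Tendsto (fun n => φ (b n)) 𝒰 (𝓝 (φ x)) := by
  obtain ⟨ν, hν, h⟩ : ∃ ν : StrongDual ℝ F, PosFunctional F ν ∧
      ¬ Tendsto (fun n => ν |b n|) atTop (𝓝 0) := by
    by_contra! h
    exact hn (hF.tendsto_norm h)
  obtain ⟨ε, hε, hfr⟩ := frequently_le_of_not_tendsto_zero (fun n => hν _ (abs_nonneg _)) h
  -- The ultrafilter lives on the indices where `ν |b n|` is large.
  have : NeBot (atTop ⊓ 𝓟 {n | ε ≤ ν |b n|}) := frequently_mem_iff_neBot.1 hfr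
  have hle := Ultrafilter.of_le (atTop ⊓ 𝓟 {n | ε ≤ ν |b n|})
  refine ⟨_, hle.trans inf_le_left, fun x hx => ?_⟩
  obtain ⟨σ, φ, hφσ, -, hφ, hσ⟩ := exists_sign_functional hν hb
  -- Each `σ k` vanishes at all late terms, hence at `x`. The series for `φ` is only known to
  -- converge at points of `F`, so membership of `x` in `F` is essential.
  have h0 : φ x = 0 := by
    rw [hφσ]
    refine (tsum_congr fun k => ?_).trans tsum_zero
    refine tendsto_nhds_unique (hx (σ k)) (tendsto_const_nhds.congr' ?_)
    filter_upwards [hle.trans inf_le_left (eventually_gt_atTop k)] with n hnk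
    exact (hσ n k (ne_of_gt hnk)).symm
  have h1 : ε ≤ φ x := by
    refine ge_of_tendsto (hx φ) ?_
    filter_upwards [hle.trans inf_le_right (mem_principal_self _)] with n hn
    rw [hφ]
    exact hn
  linarith

omit [IsOrderedModule ℝ F] in
-- In a reflexive `E` the bounded sequence `e` converges weakly in `E` along every ultrafilter; the
-- disjoint sequence `f`, asymptotic to `e`, then has the same limit in `F`.
theorem PositiveSchur.dispersed (hF : PositiveSchur F) (E : Submodule ℝ F) (hE : Reflexive E) :
    Dispersed E := by
  rintro ⟨e, heE, he1, f, hf, hfe⟩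
  have hn : ¬ Tendsto (fun n => ‖f n‖) atTop (𝓝 0) := by
    intro h
    have : Tendsto (fun n => ‖f n - e n‖ + ‖f n‖) atTop (𝓝 (0 + 0)) := hfe.add h
    have h1 : (1 : ℝ) ≤ 0 + 0 := ge_of_tendsto' this fun n => by
      rw [← he1 n, add_comm]
      calc ‖e n‖ = ‖f n - (f n - e n)‖ := by congr 1; abel
        _ ≤ _ := norm_sub_le _ _
    norm_num at h1
  obtain ⟨𝒰, h𝒰, hx⟩ := hF.exists_ultrafilter hf hn
  obtain ⟨Φ, hΦ⟩ := exists_bidual_tendsto (u := fun n => (⟨e n, heE n⟩ : E)) (C := 1)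
    (fun n => (he1 n).le) 𝒰
  obtain ⟨x, rfl⟩ := hE Φ
  refine hx x fun φ => ?_
  have h1 : Tendsto (fun n => φ (e n)) 𝒰 (𝓝 (φ x)) := hΦ (φ.comp E.subtypeL)
  have h2 : Tendsto (fun n => φ (f n - e n)) 𝒰 (𝓝 0) := by
    have := (φ.continuous.tendsto 0).comp (tendsto_zero_iff_norm_tendsto_zero.2 hfe)
    rw [map_zero] at this
    exact this.mono_left h𝒰
  simpa using h2.add h1

omit [IsOrderedModule ℝ F] in
theorem PositiveSchur.not_reflexive_of_almostDisjointSeq (hF : PositiveSchur F) {e : ℕ → F}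
    (he : AlmostDisjointSeq e) (E : Submodule ℝ F) (heE : ∀ n, e n ∈ E) : ¬ Reflexive E :=
  fun h => hF.dispersed E h ⟨e, heE, he⟩

omit [IsOrderedAddMonoid F] [HasSolidNorm F] in
theorem abs_smul_le (c : ℝ) (f : F) : |c • f| ≤ |c| • |f| := by
  wlog hc : 0 ≤ c generalizing c
  · have := this (-c) (by linarith)
    rwa [neg_smul, abs_neg, abs_neg] at this
  rw [abs_of_nonneg hc]
  refine abs_le'.2 ⟨smul_le_smul_of_nonneg_left (le_abs_self f) hc, ?_⟩
  rw [← smul_neg]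
  exact smul_le_smul_of_nonneg_left (neg_le_abs f) hc

omit [HasSolidNorm F] in
theorem abs_inf_abs_smul_eq_zero {f g : F} (h : |f| ⊓ |g| = 0) (c : ℝ) : |f| ⊓ |c • g| = 0 := by
  obtain ⟨n, hn⟩ := exists_nat_ge |c|
  refine inf_eq_zero_of_le (inf_nsmul_eq_zero (abs_nonneg _) (abs_nonneg _) h n)
    (abs_nonneg _) (abs_nonneg _) le_rfl ((abs_smul_le c g).trans ?_)
  rw [← Nat.cast_smul_eq_nsmul ℝ]
  exact smul_le_smul_of_nonneg_right hn (abs_nonneg g)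

omit [HasSolidNorm F] in
theorem abs_inf_abs_eq_zero_of_mem_span {f : F} {s : Set F} (h : ∀ g ∈ s, |f| ⊓ |g| = 0) {x : F}
    (hx : x ∈ Submodule.span ℝ s) : |f| ⊓ |x| = 0 := by
  induction hx using Submodule.span_induction with
  | mem g hg => exact h g hg
  | zero => simp
  | add x y _ _ hx hy =>
    exact inf_eq_zero_of_le (inf_add_eq_zero (abs_nonneg f) (abs_nonneg x) (abs_nonneg y) hx hy)
      (abs_nonneg _) (abs_nonneg _) le_rfl (abs_add_le _ _)
  | smul c x _ hx => exact abs_inf_abs_smul_eq_zero hx c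

theorem PositiveSchur.not_reflexive_of_disjointSeq (hF : PositiveSchur F) {f : ℕ → F}
    (hf : DisjointSeq f) (hf0 : ∀ n, f n ≠ 0) (E : Submodule ℝ F) (hfE : ∀ n, f n ∈ E) :
    ¬ Reflexive E := by
  refine hF.not_reflexive_of_almostDisjointSeq (e := fun n => ‖f n‖⁻¹ • f n)
    ⟨fun n => norm_smul_inv_norm (𝕜 := ℝ) (hf0 n), fun n => ‖f n‖⁻¹ • f n, fun m n hmn => ?_, ?_⟩ E
    fun n => E.smul_mem _ (hfE n)
  · apply abs_inf_abs_smul_eq_zero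
    rw [inf_comm]
    apply abs_inf_abs_smul_eq_zero
    rw [inf_comm, hf m n hmn]
  · simp

omit [IsOrderedModule ℝ F] in
-- The summand `σ j` of a sign functional annihilates all terms but `f j`, and isolates the `j`-th
-- coefficient.
theorem DisjointSeq.linearIndependent {f : ℕ → F} (hf : DisjointSeq f) (hf0 : ∀ n, f n ≠ 0) :
    LinearIndependent ℝ f := by
  rw [linearIndependent_iff']
  intro s c hc j hj
  obtain ⟨ν, hν, hpos⟩ := exists_posFunctional_pos (abs_nonneg (f j)) (abs_ne_zero_of_ne_zero (hf0 j))
  obtain ⟨σ, φ, hφσ, -, hφ, hσ⟩ := exists_sign_functional hν hf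
  have h1 : σ j (f j) = ν |f j| := by
    rw [← hφ, hφσ, tsum_eq_single j fun k hk => hσ j k hk.symm]
  have h2 := congrArg (σ j) hc
  rw [map_sum, Finset.sum_eq_single j (fun k _ hk => by rw [map_smul, hσ k j hk, smul_zero])
    (fun h => absurd hj h), map_smul, h1, map_zero, smul_eq_mul] at h2
  exact (mul_eq_zero.1 h2).resolve_right hpos.ne'

omit [Lattice F] [IsOrderedAddMonoid F] [HasSolidNorm F] [IsOrderedModule ℝ F] in
theorem exists_mem_span_image_Ico {f : ℕ → F} {N : ℕ} {x : F}
    (hx : x ∈ Submodule.span ℝ (f '' Set.Ici N)) :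
    ∃ M, x ∈ Submodule.span ℝ (f '' Set.Ico N M) := by
  induction hx using Submodule.span_induction with
  | mem g hg =>
    obtain ⟨k, hk, rfl⟩ := hg
    exact ⟨k + 1, Submodule.subset_span ⟨k, ⟨hk, k.lt_succ_self⟩, rfl⟩⟩
  | zero => exact ⟨0, zero_mem _⟩
  | add x y _ _ hx hy =>
    obtain ⟨M, hM⟩ := hx
    obtain ⟨K, hK⟩ := hy
    exact ⟨max M K, add_mem
      (Submodule.span_mono (Set.image_mono (Set.Ico_subset_Ico_right (le_max_left _ _))) hM)
      (Submodule.span_mono (Set.image_mono (Set.Ico_subset_Ico_right (le_max_right _ _))) hK)⟩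
  | smul c x _ hx =>
    obtain ⟨M, hM⟩ := hx
    exact ⟨M, Submodule.smul_mem _ c hM⟩

variable {H : Type*} [NormedAddCommGroup H] [NormedSpace ℝ H]

omit [IsOrderedModule ℝ F] in
-- The terms from `N` on still span an infinite-dimensional space, on which `T` is not bounded
-- below; a vector of that span uses only finitely many terms.
theorem StrictlySingular.exists_block {T : F →L[ℝ] H} {f : ℕ → F} (hf : DisjointSeq f)
    (hf0 : ∀ n, f n ≠ 0)
    (hT : StrictlySingular (T.comp (Submodule.span ℝ (Set.range f)).subtypeL)) (N : ℕ) {δ : ℝ}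
    (hδ : 0 < δ) : ∃ (x : F) (M : ℕ), N ≤ M ∧ x ∈ Submodule.span ℝ (f '' Set.Ico N M) ∧
      ‖x‖ = 1 ∧ ‖T x‖ ≤ δ := by
  let S := Submodule.span ℝ (Set.range f)
  let v : ℕ → S := fun k => ⟨f (N + k), Submodule.subset_span ⟨N + k, rfl⟩⟩
  have hv : LinearIndependent ℝ v := LinearIndependent.of_comp S.subtype
    ((hf.linearIndependent hf0).comp (fun k => N + k) (add_right_injective N))
  have hinf : ¬ FiniteDimensional ℝ (Submodule.span ℝ (Set.range v)) := fun h =>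
    not_finite_iff_infinite.2 (inferInstance : Infinite ℕ) (linearIndependent_span hv).finite
  obtain ⟨x, hx, hxT⟩ : ∃ x ∈ Submodule.span ℝ (Set.range v), ‖T x‖ < δ * ‖x‖ := by
    have := hT _ hinf
    push Not at this
    exact this δ hδ
  have hx0 : ‖x‖ ≠ 0 := by
    intro h
    rw [h, mul_zero] at hxT
    exact absurd hxT (not_lt.2 (norm_nonneg _))
  have hxI : (x : F) ∈ Submodule.span ℝ (f '' Set.Ici N) := by
    have : (x : F) ∈ (Submodule.span ℝ (Set.range v)).map S.subtype := ⟨x, hx, rfl⟩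
    rw [Submodule.map_span] at this
    refine Submodule.span_mono ?_ this
    rintro _ ⟨_, ⟨k, rfl⟩, rfl⟩
    exact ⟨N + k, Nat.le_add_right N k, rfl⟩
  obtain ⟨M, hM⟩ := exists_mem_span_image_Ico hxI
  refine ⟨‖x‖⁻¹ • (x : F), max N M, le_max_left _ _, Submodule.smul_mem _ _ (Submodule.span_mono
    (Set.image_mono (Set.Ico_subset_Ico_right (le_max_right _ _))) hM), ?_, ?_⟩
  · rw [norm_smul, norm_inv, norm_norm]
    exact inv_mul_cancel₀ hx0
  · rw [map_smul, norm_smul, norm_inv, norm_norm, inv_mul_le_iff₀ (by positivity), mul_comm]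
    exact hxT.le

/-- If `T` were strictly singular on the span, there would be normalized disjoint blocks with `T b →
0` in norm. Their weak-star limits are killed by `T**`, hence lie in `F` because `T` is tauberian,
which the positive Schur property excludes. -/
theorem PositiveSchur.disjointlyNonSingular (hF : PositiveSchur F) {T : F →L[ℝ] H}
    (hT : Tauberian T) : DisjointlyNonSingular T := by
  intro f hf hf0 hS
  choose x M hNM hxM hx1 hxT using fun N j : ℕ =>
    hS.exists_block hf hf0 N (δ := 1 / ((j : ℝ) + 1)) Nat.one_div_pos_of_nat
  -- Block `j` uses the indices in `[K j, K (j + 1))` and has image of norm at most `1 / (j + 1)`.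
  let K : ℕ → ℕ := fun j => Nat.rec 0 (fun j N => M N j) j
  have hK : Monotone K := monotone_nat_of_le_succ fun j => hNM _ _
  let b : ℕ → F := fun j => x (K j) j
  have hbd : ∀ i j, i < j → |b i| ⊓ |b j| = 0 := by
    intro i j hij
    refine abs_inf_abs_eq_zero_of_mem_span ?_ (hxM (K j) j)
    rintro _ ⟨k, hk, rfl⟩
    rw [inf_comm]
    refine abs_inf_abs_eq_zero_of_mem_span ?_ (hxM (K i) i)
    rintro _ ⟨l, hl, rfl⟩
    refine hf k l ?_
    have h1 : l < K (i + 1) := hl.2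
    have h2 : K (i + 1) ≤ K j := hK hij
    have h3 : K j ≤ k := hk.1
    omega
  have hb : DisjointSeq b := fun i j hij => (lt_or_gt_of_ne hij).elim (hbd i j) fun h => by
    rw [inf_comm, hbd j i h]
  obtain ⟨𝒰, h𝒰, hx⟩ := hF.exists_ultrafilter hb (by
    simp only [b, hx1]
    intro h
    exact one_ne_zero (tendsto_nhds_unique tendsto_const_nhds h))
  obtain ⟨Φ, hΦ⟩ := exists_bidual_tendsto (u := b) (fun n => (hx1 _ _).le) 𝒰
  have hTb : Tendsto (fun n => T (b n)) atTop (𝓝 0) :=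
    squeeze_zero_norm (fun n => hxT _ _) tendsto_one_div_add_atTop_nhds_zero_nat
  obtain ⟨y, rfl⟩ := hT Φ ⟨0, by
    ext ψ
    rw [map_zero]
    refine tendsto_nhds_unique ?_ (hΦ (ψ.comp T))
    have := (ψ.continuous.tendsto 0).comp hTb
    rw [map_zero] at this
    exact this.mono_left h𝒰⟩
  exact hx y hΦ

end PositiveSchurProperty

/-! ### Splitting elements along positive and negative parts -/

section LatticeGroups

variable {G : Type*} [AddCommGroup G] [Lattice G] [IsOrderedAddMonoid G]

theorem abs_sub_of_inf_eq_zero {a b : G} (h : a ⊓ b = 0) : |a - b| = a + b := by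
  rw [← sup_sub_inf_eq_abs_sub b a, sup_comm, inf_comm, h, sub_zero, ← inf_add_sup, h, zero_add]

/-- A positive minorant `d` of `|w|` is the absolute value of some `e` with
`|w - e| ≤ |w| - d`. -/
theorem exists_abs_eq_of_le_abs {w d : G} (hd : 0 ≤ d) (hdw : d ≤ |w|) :
    ∃ e : G, |e| = d ∧ |w - e| ≤ |w| - d := by
  have hdisj : (d ⊓ w⁺) ⊓ (d ⊓ w⁻) = 0 :=
    inf_eq_zero_of_le (posPart_inf_negPart_eq_zero w) (le_inf hd (posPart_nonneg w))
      (le_inf hd (negPart_nonneg w)) inf_le_right inf_le_right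
  have hsum : d ⊓ w⁺ + d ⊓ w⁻ = d := by
    refine le_antisymm (add_le_of_inf_eq_zero hdisj inf_le_left inf_le_left) ?_
    calc d = d ⊓ (w⁺ + w⁻) := by rw [posPart_add_negPart, inf_eq_left.2 hdw]
      _ ≤ _ := inf_add_le_inf_add_inf hd (posPart_nonneg w) (negPart_nonneg w)
  -- The witness is `d` given the signs of `w`.
  refine ⟨d ⊓ w⁺ - d ⊓ w⁻, by rw [abs_sub_of_inf_eq_zero hdisj, hsum], ?_⟩
  have e1 : w - (d ⊓ w⁺ - d ⊓ w⁻) = (w⁺ - d ⊓ w⁺) + (-(w⁻ - d ⊓ w⁻)) := by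
    nth_rw 1 [← posPart_sub_negPart w]
    abel
  have e2 : |w| - d = (w⁺ - d ⊓ w⁺) + (w⁻ - d ⊓ w⁻) := by
    calc |w| - d = (w⁺ + w⁻) - (d ⊓ w⁺ + d ⊓ w⁻) := by rw [hsum, posPart_add_negPart]
      _ = _ := by abel
  rw [e1, e2]
  refine (abs_add_le _ _).trans_eq ?_
  rw [abs_neg, abs_of_nonneg (sub_nonneg.2 inf_le_right), abs_of_nonneg (sub_nonneg.2 inf_le_right)]

theorem posPart_nsmul_le (n : ℕ) (x : G) : (n • x)⁺ ≤ n • x⁺ :=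
  sup_le (nsmul_le_nsmul_right (le_posPart x) n) (nsmul_nonneg (posPart_nonneg x) n)

end LatticeGroups

/-! ### Disjointification of weakly null, uaw-null sequences -/

section Disjointification

variable {F : Type*} [NormedAddCommGroup F] [Lattice F] [IsOrderedAddMonoid F]
  [HasSolidNorm F] [NormedSpace ℝ F] [IsOrderedModule ℝ F]

/-- A sequence which grows fast with respect to a positive functional and becomes small on
order bounded sets can be approximated from below by a disjoint sequence. -/
theorem exists_disjoint_minorants [CompleteSpace F] {ν : StrongDual ℝ F}
    (hν : PosFunctional F ν) {w : ℕ → F} {C : ℝ} (hw : ∀ n, ‖w n‖ ≤ C)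
    (hs : Tendsto (fun k => ν (|w k| ⊓ (4 ^ k) • ∑ j ∈ Finset.range k, |w j|)) atTop (𝓝 0)) :
    ∃ d : ℕ → F, (∀ k, 0 ≤ d k) ∧ (∀ k, d k ≤ |w k|) ∧ (∀ j k, j < k → d j ⊓ d k = 0) ∧
      Tendsto (fun k => ν (|w k| - d k)) atTop (𝓝 0) := by
  let g : ℕ → F := fun j => ((1 / 4 : ℝ) ^ j) • |w j|
  have hg0 : ∀ j, 0 ≤ g j := fun j => smul_nonneg (by positivity) (abs_nonneg _)
  have hgs : Summable g := by
    refine Summable.of_norm_bounded (g := fun j => (1 / 4 : ℝ) ^ j * C)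
      ((summable_geometric_of_lt_one (by norm_num) (by norm_num)).mul_right C) fun j => ?_
    rw [norm_smul, norm_abs_eq_norm, Real.norm_of_nonneg (by positivity)]
    exact mul_le_mul_of_nonneg_left (hw j) (by positivity)
  let t : ℕ → F := fun k => ∑' i, g (i + (k + 1))
  let h : ℕ → F := fun k => (4 ^ k) • ∑ j ∈ Finset.range k, |w j|
  have hh0 : ∀ k, 0 ≤ h k := fun k =>
    nsmul_nonneg (Finset.sum_nonneg fun j _ => abs_nonneg _) _
  have ht0 : ∀ k, 0 ≤ t k := fun k => tsum_nonneg fun i => hg0 _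
  have htend : Tendsto t atTop (𝓝 0) := (tendsto_sum_nat_add g).comp (tendsto_add_atTop_nat 1)
  have htle : ∀ j k, j < k → g k ≤ t j := by
    intro j k hjk
    have := ((summable_nat_add_iff (j + 1)).2 hgs).le_tsum (k - (j + 1)) fun i _ => hg0 _
    rwa [Nat.sub_add_cancel (Nat.succ_le_of_lt hjk)] at this
  -- Subtracting `h k` separates `d k` from the earlier terms, subtracting the tail `t k` separates
  -- it from the later ones.
  refine ⟨fun k => (|w k| - (h k + t k))⁺, fun k => posPart_nonneg _, fun k => ?_,
    fun j k hjk => ?_, ?_⟩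
  · exact sup_le (sub_le_self _ (add_nonneg (hh0 k) (ht0 k))) (abs_nonneg _)
  -- For `j < k`, `d j` lies below the positive part of `|w j| - g k` and `d k` below a multiple of
  -- its negative part, as `4 ^ k • g k = |w k|`.
  · have h1 : (|w j| - (h j + t j))⁺ ≤ (|w j| - g k)⁺ :=
      posPart_mono (sub_le_sub_left ((htle j k hjk).trans (le_add_of_nonneg_left (hh0 j))) _)
    have h2 : (|w k| - (h k + t k))⁺ ≤ (4 ^ k) • (|w j| - g k)⁻ := by
      refine (posPart_mono (b := (4 ^ k) • -(|w j| - g k)) ?_).trans (posPart_nsmul_le _ _)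
      have e : (4 ^ k) • g k = |w k| := by
        rw [← Nat.cast_smul_eq_nsmul ℝ, smul_smul]
        push_cast
        rw [← mul_pow]
        norm_num
      rw [neg_sub, nsmul_sub, e]
      refine sub_le_sub_left (le_trans ?_ (le_add_of_nonneg_right (ht0 k))) _
      exact nsmul_le_nsmul_right (Finset.single_le_sum (f := fun j => |w j|)
        (fun _ _ => abs_nonneg _) (Finset.mem_range.2 hjk)) _
    exact inf_eq_zero_of_le (inf_nsmul_eq_zero (posPart_nonneg _) (negPart_nonneg _)
      (posPart_inf_negPart_eq_zero _) _) (posPart_nonneg _) (posPart_nonneg _) h1 h2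
  · have h3 : Tendsto (fun k => ν (|w k| ⊓ h k) + ν (t k)) atTop (𝓝 0) := by
      simpa using hs.add ((ν.continuous.tendsto 0).comp htend)
    refine squeeze_zero (fun k => hν _ (sub_nonneg.2 ?_)) (fun k => ?_) h3
    · exact sup_le (sub_le_self _ (add_nonneg (hh0 k) (ht0 k))) (abs_nonneg _)
    · rw [← inf_eq_sub_posPart_sub, ← map_add]
      exact hν.mono ((inf_add_le_inf_add_inf (abs_nonneg _) (hh0 k) (ht0 k)).trans
        (add_le_add_right inf_le_right _))

/-- A weakly null sequence converging to zero in the unbounded absolute weak topology converges to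
zero in the absolute weak topology. -/
theorem WeaklyNull.tendsto_posFunctional_abs [CompleteSpace F] {u : ℕ → F} (hu : WeaklyNull u)
    {ν : StrongDual ℝ F} (hν : PosFunctional F ν)
    (hm : ∀ h : F, 0 ≤ h → Tendsto (fun n => ν (h ⊓ |u n|)) atTop (𝓝 0)) :
    Tendsto (fun n => ν |u n|) atTop (𝓝 0) := by
  by_contra hcon
  obtain ⟨ε, hε, hfr⟩ := frequently_le_of_not_tendsto_zero (fun n => hν _ (abs_nonneg _)) hcon
  obtain ⟨C, hC⟩ := hu.exists_norm_le
  -- The selection step: `m` is the last index chosen, `k` the stage and `h` the sum of the absolute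
  -- values chosen so far. Writing `|h|` makes the choice total.
  have hnext : ∀ (m k : ℕ) (h : F), ∃ n, m < n ∧ ε ≤ ν |u n| ∧
      ν (|u n| ⊓ (4 ^ k) • |h|) < 1 / ((k : ℝ) + 1) := by
    intro m k h
    have h1 := (hm _ (nsmul_nonneg (abs_nonneg h) (4 ^ k))).eventually_lt_const
      (Nat.one_div_pos_of_nat (n := k) (α := ℝ))
    obtain ⟨n, ⟨hn1, hn2⟩, hn3⟩ := (hfr.and_eventually h1 |>.and_eventually
      (eventually_gt_atTop m)).exists
    exact ⟨n, hn3, hn1, by rwa [inf_comm]⟩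
  choose N hNgt hNε hNs using hnext
  let s : ℕ → ℕ × F := fun k => Nat.rec (0, 0)
    (fun k p => (N p.1 k p.2, p.2 + |u (N p.1 k p.2)|)) k
  -- The shift skips the dummy initial index in `s 0`.
  let w : ℕ → F := fun k => u (s (k + 1)).1
  have hsum : ∀ k, (s k).2 = ∑ j ∈ Finset.range k, |w j| := by
    intro k
    induction k with
    | zero => rfl
    | succ k ih => rw [Finset.sum_range_succ, ← ih]
  have hmono : StrictMono fun k => (s (k + 1)).1 :=
    strictMono_nat_of_lt_succ fun k => hNgt (s (k + 1)).1 (k + 1) (s (k + 1)).2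
  have hwε : ∀ k, ε ≤ ν |w k| := fun k => hNε (s k).1 k (s k).2
  have hws : Tendsto (fun k => ν (|w k| ⊓ (4 ^ k) • ∑ j ∈ Finset.range k, |w j|)) atTop
      (𝓝 0) := by
    refine squeeze_zero (fun k => hν _ (le_inf (abs_nonneg _)
      (nsmul_nonneg (Finset.sum_nonneg fun j _ => abs_nonneg (w j)) _))) (fun k => ?_)
      tendsto_one_div_add_atTop_nhds_zero_nat
    have := hNs (s k).1 k (s k).2
    have habs : |(s k).2| = ∑ j ∈ Finset.range k, |w j| := by
      rw [hsum, abs_of_nonneg (Finset.sum_nonneg fun j _ => abs_nonneg _)]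
    rw [habs] at this
    exact this.le
  obtain ⟨d, hd0, hdw, hdd, hdν⟩ := exists_disjoint_minorants hν (fun k => hC _) hws
  choose e he hwe using fun k => exists_abs_eq_of_le_abs (hd0 k) (hdw k)
  have hed : DisjointSeq e := by
    intro i j hij
    rw [he, he]
    rcases lt_or_gt_of_ne hij with h | h
    · exact hdd i j h
    · rw [inf_comm, hdd j i h]
  obtain ⟨-, φ, -, hφν, hφ, -⟩ := exists_sign_functional hν hed
  have hφw : Tendsto (fun k => φ (w k)) atTop (𝓝 0) :=
    (weaklyNull_iff.1 hu φ).comp hmono.tendsto_atTop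
  -- This bounds `ν |w k|`: one error term replaces `|w k|` by `d k`, the other replaces `e k` by `w
  -- k` inside `φ`, where `φ (e k) = ν (d k)`.
  have hlim : Tendsto (fun k => |φ (w k)| + (ν (|w k| - d k) + ν (|w k| - d k))) atTop (𝓝 0) := by
    simpa using hφw.abs.add (hdν.add hdν)
  have : ε ≤ 0 := ge_of_tendsto' hlim fun k => by
    have h1 : φ (w k) = ν (d k) + φ (w k - e k) := by rw [map_sub, hφ, he]; ring
    have h2 : |φ (w k - e k)| ≤ ν (|w k| - d k) := (hφν _).trans (hν.mono (hwe k))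
    have h3 := hwε k
    have h4 : ν (|w k| - d k) = ν |w k| - ν (d k) := map_sub _ _ _
    have h5 := le_abs_self (φ (w k))
    have h6 := abs_le.1 h2
    linarith
  linarith

end Disjointification

/-! ### Order continuous norms and order completeness -/

section OrderContinuity

variable {F : Type*} [NormedAddCommGroup F] [Lattice F] [IsOrderedAddMonoid F]
  [HasSolidNorm F] [NormedSpace ℝ F] [IsOrderedModule ℝ F]

omit [IsOrderedModule ℝ F] [NormedSpace ℝ F] in
/-- A downward directed set whose net is Cauchy has an infimum, which is a norm limit. -/
theorem exists_isGLB_of_cauchy [CompleteSpace F] {D : Set F}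
    (hdir : DirectedOn (· ≥ ·) D)
    (hC : ∀ ε > 0, ∃ c ∈ D, ∀ d ∈ D, d ≤ c → ‖c - d‖ < ε) :
    ∃ x, IsGLB D x ∧ ∀ ε > 0, ∃ d ∈ D, ‖d - x‖ < ε := by
  choose c hcD hc using fun n : ℕ => hC (1 / ((n : ℝ) + 1)) Nat.one_div_pos_of_nat
  choose g hgD hg using fun (p q : D) => hdir p p.2 q q.2
  -- Directedness replaces the `c n` by a decreasing sequence, whose norm limit will be the infimum.
  obtain ⟨a, haD, hac, hanti⟩ : ∃ a : ℕ → F, (∀ n, a n ∈ D) ∧ (∀ n, a n ≤ c n) ∧ Antitone a := by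
    let b : ℕ → D := fun n => Nat.rec ⟨c 0, hcD 0⟩
      (fun n p => ⟨g p ⟨c (n + 1), hcD _⟩, hgD _ _⟩) n
    refine ⟨fun n => (b n).1, fun n => (b n).2, fun n => ?_, antitone_nat_of_succ_le fun n =>
      (hg (b n) ⟨c (n + 1), hcD _⟩).1⟩
    cases n with
    | zero => exact le_rfl
    | succ n => exact (hg (b n) ⟨c (n + 1), hcD _⟩).2
  have ha : ∀ n, ∀ d ∈ D, d ≤ a n → ‖a n - d‖ < 1 / ((n : ℝ) + 1) := fun n d hd hda =>
    (norm_le_norm_of_le (sub_nonneg.2 hda) (sub_le_sub_right (hac n) d)).trans_lt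
      (hc n d hd (hda.trans (hac n)))
  have hcau : CauchySeq fun n => a n := by
    rw [Metric.cauchySeq_iff']
    intro ε hε
    obtain ⟨n, hn⟩ := exists_nat_one_div_lt hε
    refine ⟨n, fun m hm => ?_⟩
    rw [dist_comm, dist_eq_norm]
    exact (ha n _ (haD m) (hanti hm)).trans hn
  obtain ⟨x, hx⟩ := cauchySeq_tendsto_of_complete hcau
  refine ⟨x, ⟨fun d hd => ?_, fun y hy => ge_of_tendsto' hx fun n => hy (haD n)⟩, fun ε hε => ?_⟩
  · have h1 : Tendsto (fun n => (a n - d)⁺) atTop (𝓝 (x - d)⁺) :=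
      (continuous_posPart.tendsto _).comp (hx.sub_const d)
    have h2 : Tendsto (fun n => (a n - d)⁺) atTop (𝓝 0) := by
      refine squeeze_zero_norm (fun n => ?_) tendsto_one_div_add_atTop_nhds_zero_nat
      -- A common minorant `z` of `a n` and `d` in `D` gives `(a n - d)⁺ ≤ a n - z`, which is small.
      obtain ⟨z, hz, hz1, hz2⟩ := hdir (a n) (haD n) d hd
      refine (norm_le_norm_of_le (posPart_nonneg _) ?_).trans (ha n z hz hz1).le
      exact sup_le (sub_le_sub_left hz2 _) (sub_nonneg.2 hz1)
    exact sub_nonpos.1 (posPart_eq_zero.1 (tendsto_nhds_unique h1 h2))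
  · obtain ⟨n, hn⟩ := (Metric.tendsto_atTop.1 hx) ε hε
    exact ⟨a n, (haD n), by rw [← dist_eq_norm]; exact hn n le_rfl⟩

/-- The sets `{f | |f| ≤ d}` generate the largest filter that `D` witnesses to be order null; by
directedness a single `d` suffices. -/
theorem exists_mem_of_orderContinuousTopology {G : Type*} [AddCommGroup G] [Lattice G]
    {t : TopologicalSpace G} (ht : OrderContinuousTopology t) {D : Set G} (hD : D.Nonempty)
    (hdir : DirectedOn (· ≥ ·) D) (h0 : IsGLB D 0) {V : Set G} (hV : V ∈ @nhds G t 0) :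
    ∃ d ∈ D, ∀ f, |f| ≤ d → f ∈ V := by
  have hl : OrderNull (⨅ d ∈ D, 𝓟 {f : G | |f| ≤ d}) :=
    ⟨D, hD, hdir, h0, fun d hd => mem_iInf_of_mem d (mem_iInf_of_mem hd (mem_principal_self _))⟩
  have := ht _ hl hV
  rw [mem_biInf_of_directed (fun a ha b hb => by
    obtain ⟨c, hc, hca, hcb⟩ := hdir a ha b hb
    exact ⟨c, hc, principal_mono.2 fun f hf => le_trans hf hca,
      principal_mono.2 fun f hf => le_trans hf hcb⟩) hD] at this
  obtain ⟨d, hd, h⟩ := this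
  exact ⟨d, hd, h⟩

omit [HasSolidNorm F] in
omit [NormedSpace ℝ F] [IsOrderedModule ℝ F] in
theorem OrderContinuous.exists_norm_lt (hF : OrderContinuous F) {D : Set F} (hD : D.Nonempty)
    (hdir : DirectedOn (· ≥ ·) D) (h0 : IsGLB D 0) {ε : ℝ} (hε : 0 < ε) : ∃ d ∈ D, ‖d‖ < ε := by
  obtain ⟨d, hd, h⟩ := exists_mem_of_orderContinuousTopology hF hD hdir h0
    (Metric.ball_mem_nhds 0 hε)
  exact ⟨d, hd, by simpa using h d (abs_of_nonneg (h0.1 hd)).le⟩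

omit [NormedSpace ℝ F] [IsOrderedModule ℝ F] in
theorem orderContinuous_of_exists_norm_lt (h : ∀ D : Set F, D.Nonempty →
    DirectedOn (· ≥ ·) D → IsGLB D 0 → ∀ ε > 0, ∃ d ∈ D, ‖d‖ < ε) : OrderContinuous F := by
  rintro l ⟨D, hD, hdir, h0, hl⟩ V hV
  obtain ⟨ε, hε, hεV⟩ := Metric.mem_nhds_iff.1 hV
  obtain ⟨d, hd, hdε⟩ := h D hD hdir h0 ε hε
  filter_upwards [hl d hd] with f hf
  refine hεV ?_
  rw [mem_ball_zero_iff, ← norm_abs_eq_norm]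
  exact (norm_le_norm_of_le (abs_nonneg f) hf).trans_lt hdε

omit [IsOrderedModule ℝ F] in
-- If `D` were not Cauchy, it would contain a decreasing sequence with steps of norm at least `ε`.
-- The steps are positive and their `ν`-values have telescoping sums at most `ν (s 0)`, so they are
-- weakly null, against the positive Schur property.
theorem PositiveSchur.orderContinuous [CompleteSpace F] (hF : PositiveSchur F) :
    OrderContinuous F := by
  refine orderContinuous_of_exists_norm_lt fun D hD hdir h0 => ?_
  obtain ⟨x, hx, hlim⟩ := exists_isGLB_of_cauchy hdir (by
    by_contra! hcon
    obtain ⟨ε, hε, hcon⟩ := hcon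
    choose! g hgD hgle hg using hcon
    obtain ⟨d₀, hd₀⟩ := hD
    let s : ℕ → F := fun n => g^[n] d₀
    have hs : ∀ n, s (n + 1) = g (s n) := fun n => Function.iterate_succ_apply' g n d₀
    have hsD : ∀ n, s n ∈ D := by
      intro n
      induction n with
      | zero => exact hd₀
      | succ n ih => rw [hs]; exact hgD _ ih
    have hpos : ∀ n, 0 ≤ s n - s (n + 1) := fun n => by
      rw [hs]; exact sub_nonneg.2 (hgle _ (hsD n))
    have hnull : Tendsto (fun n => ‖s n - s (n + 1)‖) atTop (𝓝 0) := by
      refine hF _ hpos (weaklyNull_of_forall_posFunctional fun ν hν => ?_)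
      refine (summable_of_sum_range_le (c := ν (s 0)) (fun n => hν _ (hpos n))
        fun n => ?_).tendsto_atTop_zero
      rw [← map_sum, Finset.sum_range_sub']
      exact hν.mono (sub_le_self _ (h0.1 (hsD n)))
    have : ε ≤ 0 := ge_of_tendsto' hnull fun n => by rw [hs]; exact hg _ (hsD n)
    linarith)
  obtain rfl := hx.unique h0
  simpa using hlim

theorem nonpos_of_forall_nsmul_le {z w : F} (h : ∀ n : ℕ, n • z ≤ w) : z ≤ 0 := by
  have h1 : Tendsto (fun n : ℕ => (1 / ((n : ℝ) + 1)) • w) atTop (𝓝 0) := by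
    simpa using (tendsto_one_div_add_atTop_nhds_zero_nat (𝕜 := ℝ)).smul_const w
  refine ge_of_tendsto' h1 fun n => ?_
  have h2 := smul_le_smul_of_nonneg_left (h (n + 1))
    (Nat.one_div_pos_of_nat (n := n) (α := ℝ)).le
  rw [← Nat.cast_smul_eq_nsmul ℝ, smul_smul] at h2
  push_cast at h2
  rwa [one_div_mul_cancel (by positivity), one_smul] at h2

/-- The differences `d - l`, with `l` a lower bound of `D`, decrease to zero: if `z` lies below all
of them, every `l + n • z` is again a lower bound, so `z ≤ 0`. Order continuity makes them small in
norm, hence `D` is Cauchy. -/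
theorem OrderContinuous.exists_isGLB [CompleteSpace F] (hF : OrderContinuous F) {D : Set F}
    (hD : D.Nonempty) (hdir : DirectedOn (· ≥ ·) D) (hbd : BddBelow D) : ∃ x, IsGLB D x := by
  obtain ⟨x, hx, -⟩ := exists_isGLB_of_cauchy hdir fun ε hε => by
    let D' : Set F := {z | ∃ d ∈ D, ∃ l ∈ lowerBounds D, d - l = z}
    obtain ⟨_, ⟨d, hd, l, hl, rfl⟩, hlt⟩ := hF.exists_norm_lt (D := D')
      (by
        obtain ⟨d, hd⟩ := hD
        obtain ⟨l, hl⟩ := hbd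
        exact ⟨_, d, hd, l, hl, rfl⟩)
      (by
        rintro _ ⟨d, hd, l, hl, rfl⟩ _ ⟨d', hd', l', hl', rfl⟩
        obtain ⟨c, hc, hcd, hcd'⟩ := hdir d hd d' hd'
        exact ⟨_, ⟨c, hc, l ⊔ l', fun e he => sup_le (hl he) (hl' he), rfl⟩,
          sub_le_sub hcd le_sup_left, sub_le_sub hcd' le_sup_right⟩)
      (by
        refine ⟨?_, fun z hz => ?_⟩
        · rintro _ ⟨d, hd, l, hl, rfl⟩
          exact sub_nonneg.2 (hl hd)
        · obtain ⟨d, hd⟩ := hD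
          obtain ⟨l, hl⟩ := hbd
          have hn : ∀ n : ℕ, l + n • z ∈ lowerBounds D := by
            intro n
            induction n with
            | zero => simpa using hl
            | succ n ih =>
              intro e he
              rw [succ_nsmul, ← add_assoc, ← le_sub_iff_add_le']
              exact hz ⟨e, he, _, ih, rfl⟩
          exact nonpos_of_forall_nsmul_le (w := d - l) fun n => le_sub_iff_add_le'.2 (hn n hd)) hε
    refine ⟨d, hd, fun e he hed => lt_of_le_of_lt ?_ hlt⟩
    exact norm_le_norm_of_le (sub_nonneg.2 hed) (sub_le_sub_left (hl he) d)
  exact ⟨x, hx⟩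

theorem OrderContinuous.exists_isLUB [CompleteSpace F] (hF : OrderContinuous F) {A : Set F}
    (hA : A.Nonempty) (hdir : DirectedOn (· ≤ ·) A) (hbd : BddAbove A) : ∃ x, IsLUB A x := by
  obtain ⟨x, hx⟩ := hF.exists_isGLB (D := -A) hA.neg (by
    intro a ha b hb
    obtain ⟨c, hc, hac, hbc⟩ := hdir _ ha _ hb
    exact ⟨-c, by simpa using hc, neg_le.1 hac, neg_le.1 hbc⟩) hbd.neg
  exact ⟨-x, isGLB_neg'.1 (by simpa using hx)⟩

end OrderContinuity

/-! ### Linear topologies generated by subadditive functions -/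

section LinearTopologies

variable {G ι : Type*} [AddCommGroup G] [t : TopologicalSpace G] {ρ : ι → G → ℝ}

theorem tendsto_iff_of_mem_nhds_iff
    (hmem : ∀ (U : Set G) (f : G), U ∈ 𝓝 f ↔ ∃ i, ∃ ε > 0, ∀ g, ρ i (g - f) < ε → g ∈ U)
    (hnn : ∀ i f, 0 ≤ ρ i f) {α : Type*} {l : Filter α} {u : α → G} {f : G} :
    Tendsto u l (𝓝 f) ↔ ∀ i, Tendsto (fun a => ρ i (u a - f)) l (𝓝 0) := by
  constructor
  · intro h i
    rw [Metric.tendsto_nhds]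
    intro ε hε
    filter_upwards [h ((hmem {g | ρ i (g - f) < ε} f).2 ⟨i, ε, hε, fun _ => id⟩)] with a ha
    rw [Real.dist_eq, sub_zero, abs_of_nonneg (hnn _ _)]
    exact ha
  · intro h U hU
    obtain ⟨i, ε, hε, H⟩ := (hmem U f).1 hU
    change ∀ᶠ a in l, u a ∈ U
    filter_upwards [(h i).eventually_lt_const hε] with a ha
    exact H _ ha

theorem isTopologicalAddGroup_of_mem_nhds_iff
    (hmem : ∀ (U : Set G) (f : G), U ∈ 𝓝 f ↔ ∃ i, ∃ ε > 0, ∀ g, ρ i (g - f) < ε → g ∈ U)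
    (hnn : ∀ i f, 0 ≤ ρ i f) (hadd : ∀ i f g, ρ i (f + g) ≤ ρ i f + ρ i g)
    (hneg : ∀ i f, ρ i (-f) = ρ i f) : IsTopologicalAddGroup G where
  continuous_add := by
    rw [continuous_iff_continuousAt]
    rintro ⟨a, b⟩
    refine (tendsto_iff_of_mem_nhds_iff hmem hnn).2 fun i => ?_
    have h1 := (tendsto_iff_of_mem_nhds_iff hmem hnn).1 (continuous_fst.tendsto (a, b)) i
    have h2 := (tendsto_iff_of_mem_nhds_iff hmem hnn).1 (continuous_snd.tendsto (a, b)) i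
    refine squeeze_zero (fun _ => hnn _ _) (fun p => ?_) (by simpa using h1.add h2)
    rw [show p.1 + p.2 - (a + b) = (p.1 - a) + (p.2 - b) by abel]
    exact hadd _ _ _
  continuous_neg := by
    rw [continuous_iff_continuousAt]
    intro a
    refine (tendsto_iff_of_mem_nhds_iff hmem hnn).2 fun i => ?_
    have h1 := (tendsto_iff_of_mem_nhds_iff hmem hnn).1 (continuous_id.tendsto a) i
    refine h1.congr fun b => ?_
    rw [show -b - -a = -(b - a) by abel, hneg]
    rfl

theorem continuousSMul_of_mem_nhds_iff [Module ℝ G]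
    (hmem : ∀ (U : Set G) (f : G), U ∈ 𝓝 f ↔ ∃ i, ∃ ε > 0, ∀ g, ρ i (g - f) < ε → g ∈ U)
    (hnn : ∀ i f, 0 ≤ ρ i f) (hadd : ∀ i f g, ρ i (f + g) ≤ ρ i f + ρ i g)
    (hsmul : ∀ i (n : ℕ) (c : ℝ) f, |c| ≤ n → ρ i (c • f) ≤ n * ρ i f)
    (hlim : ∀ i f, Tendsto (fun c : ℝ => ρ i (c • f)) (𝓝 0) (𝓝 0)) : ContinuousSMul ℝ G where
  continuous_smul := by
    rw [continuous_iff_continuousAt]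
    rintro ⟨c, f⟩
    refine (tendsto_iff_of_mem_nhds_iff hmem hnn).2 fun i => ?_
    obtain ⟨n, hn⟩ := exists_nat_gt |c|
    have h1 := (tendsto_iff_of_mem_nhds_iff hmem hnn).1 (continuous_snd.tendsto (c, f)) i
    have h2 : Tendsto (fun p : ℝ × G => ρ i ((p.1 - c) • f)) (𝓝 (c, f)) (𝓝 0) := by
      have : Tendsto (fun p : ℝ × G => p.1 - c) (𝓝 (c, f)) (𝓝 0) := by
        simpa using (continuous_fst.tendsto (c, f)).sub_const c
      exact (hlim i f).comp this
    refine squeeze_zero' (Eventually.of_forall fun _ => hnn _ _) ?_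
      (by simpa using (h1.const_mul (n : ℝ)).add h2)
    filter_upwards [(continuous_fst.tendsto (c, f)).abs.eventually_lt_const hn] with p hp
    rw [show p.1 • p.2 - c • f = p.1 • (p.2 - f) + (p.1 - c) • f by
      rw [smul_sub, sub_smul]; abel]
    exact (hadd _ _ _).trans (add_le_add_left (hsmul i n _ _ hp.le) _)

end LinearTopologies

/-! ### Comparison with the norm on order intervals -/

section Amemiya

variable {F : Type*} [NormedAddCommGroup F] [Lattice F] [IsOrderedAddMonoid F]
  [HasSolidNorm F] [NormedSpace ℝ F] [IsOrderedModule ℝ F] [CompleteSpace F]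

/-- A decreasing sequence of solid members of `N`, each containing the sum of two copies of the
next. -/
structure SolidString (N : Filter F) (W : ℕ → Set F) : Prop where
  mem : ∀ n, W n ∈ N
  solid : ∀ n, LatticeOrderedAddCommGroup.IsSolid (W n)
  add_mem : ∀ n, ∀ a ∈ W (n + 1), ∀ b ∈ W (n + 1), a + b ∈ W n

omit [HasSolidNorm F] [NormedSpace ℝ F] [IsOrderedModule ℝ F] [CompleteSpace F] in
theorem mem_of_isSolid {V : Set F} (hV : LatticeOrderedAddCommGroup.IsSolid V) {x y : F}
    (hx : x ∈ V) (hy : 0 ≤ y) (hyx : y ≤ x) : y ∈ V :=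
  hV hx (by rwa [abs_of_nonneg hy, abs_of_nonneg (hy.trans hyx)])

variable {N : Filter F}
  (hN : ∀ V ∈ N, ∃ W ∈ N, LatticeOrderedAddCommGroup.IsSolid W ∧ ∀ a ∈ W, ∀ b ∈ W, a + b ∈ V)
  (hND : ∀ D : Set F, D.Nonempty → DirectedOn (· ≥ ·) D → IsGLB D 0 → ∀ V ∈ N, ∃ d ∈ D, d ∈ V)

omit [IsOrderedAddMonoid F] [HasSolidNorm F] [NormedSpace ℝ F] [IsOrderedModule ℝ F]
  [CompleteSpace F] in
include hN in
theorem exists_solidString {V : Set F} (hV : V ∈ N) :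
    ∃ W : ℕ → Set F, SolidString N W ∧ ∀ a ∈ W 0, ∀ b ∈ W 0, a + b ∈ V := by
  choose! g hgN hg hga using hN
  have hW : ∀ n, g^[n] (g V) ∈ N := by
    intro n
    induction n with
    | zero => exact hgN _ hV
    | succ n ih => rw [Function.iterate_succ_apply']; exact hgN _ ih
  refine ⟨fun n => g^[n] (g V), ⟨hW, fun n => ?_, fun n => ?_⟩, hga V hV⟩
  · cases n with
    | zero => exact hg _ hV
    | succ n => rw [Function.iterate_succ_apply']; exact hg _ (hW n)
  · rw [Function.iterate_succ_apply']
    exact hga _ (hW n)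

omit [HasSolidNorm F] [NormedSpace ℝ F] [IsOrderedModule ℝ F] [CompleteSpace F] in
include hND in
-- The set `x - A` decreases to zero, so `x` is a small element plus a member of `A`; this costs one
-- index.
theorem SolidString.isLUB_mem {W : ℕ → Set F} (hW : SolidString N W) {A : Set F}
    (hA : A.Nonempty) (hdir : DirectedOn (· ≤ ·) A) {x : F} (hx : IsLUB A x) {n : ℕ}
    (hAW : A ⊆ W (n + 1)) : x ∈ W n := by
  obtain ⟨_, ⟨a, ha, rfl⟩, haW⟩ := hND ((fun a => x - a) '' A) (hA.image _)
    (by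
      rintro _ ⟨a, ha, rfl⟩ _ ⟨b, hb, rfl⟩
      obtain ⟨c, hc, hac, hbc⟩ := hdir a ha b hb
      exact ⟨_, ⟨c, hc, rfl⟩, sub_le_sub_left hac x, sub_le_sub_left hbc x⟩)
    (by
      refine ⟨?_, fun z hz => ?_⟩
      · rintro _ ⟨a, ha, rfl⟩
        exact sub_nonneg.2 (hx.1 ha)
      · have : x ≤ x - z := hx.2 fun a ha => le_sub_comm.1 (hz ⟨a, ha, rfl⟩)
        simpa using this) (W (n + 1)) (hW.mem _)
  have := hW.add_mem n _ haW _ (hAW ha)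
  simpa using this

variable (hN0 : ∀ V ∈ N, (0 : F) ∈ V)

omit [IsOrderedAddMonoid F] [HasSolidNorm F] [NormedSpace ℝ F] [IsOrderedModule ℝ F]
  [CompleteSpace F] in
include hN0 in
theorem SolidString.subset {W : ℕ → Set F} (hW : SolidString N W) (n : ℕ) : W (n + 1) ⊆ W n :=
  fun a ha => by simpa using hW.add_mem n a ha 0 (hN0 _ (hW.mem _))

omit [HasSolidNorm F] [NormedSpace ℝ F] [IsOrderedModule ℝ F] [CompleteSpace F] in
theorem SolidString.sup_mem {W : ℕ → Set F} (hW : SolidString N W) {n : ℕ} {a b : F}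
    (ha0 : 0 ≤ a) (hb0 : 0 ≤ b) (ha : a ∈ W (n + 1)) (hb : b ∈ W (n + 1)) : a ⊔ b ∈ W n :=
  mem_of_isSolid (hW.solid n) (hW.add_mem n a ha b hb) (ha0.trans le_sup_left)
    (sup_le (le_add_of_nonneg_right hb0) (le_add_of_nonneg_left ha0))

include hND hN0 in
theorem SolidString.exists_isGreatest (hF : OrderContinuous F) {W : ℕ → Set F}
    (hW : SolidString N W) {h : F} (hh : 0 ≤ h) :
    ∃ x, IsGreatest {x | 0 ≤ x ∧ x ≤ h ∧ ∀ n, x ∈ W n} x := by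
  have hne : {x | 0 ≤ x ∧ x ≤ h ∧ ∀ n, x ∈ W n}.Nonempty :=
    ⟨0, le_rfl, hh, fun n => hN0 _ (hW.mem n)⟩
  have hdir : DirectedOn (· ≤ ·) {x | 0 ≤ x ∧ x ≤ h ∧ ∀ n, x ∈ W n} :=
    fun a ha b hb => ⟨a ⊔ b, ⟨ha.1.trans le_sup_left, sup_le ha.2.1 hb.2.1, fun n =>
      hW.sup_mem ha.1 hb.1 (ha.2.2 _) (hb.2.2 _)⟩, le_sup_left, le_sup_right⟩
  obtain ⟨x, hx⟩ := hF.exists_isLUB hne hdir ⟨h, fun a ha => ha.2.1⟩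
  exact ⟨x, ⟨hx.1 ⟨le_rfl, hh, fun n => hN0 _ (hW.mem n)⟩, hx.2 fun a ha => ha.2.1,
    fun n => hW.isLUB_mem hND hne hdir hx fun a ha => ha.2.2 _⟩, hx.1⟩

include hND hN0 in
/-- The order limit superior of an order bounded sequence along a solid string. -/
theorem SolidString.exists_limsup (hF : OrderContinuous F) {W : ℕ → Set F}
    (hW : SolidString N W) {h : F} {g : ℕ → F} (hgW : ∀ n, g n ∈ W (n + 2)) (hg0 : ∀ n, 0 ≤ g n)
    (hgh : ∀ n, g n ≤ h) {ε : ℝ} (hgε : ∀ n, ε ≤ ‖g n‖) :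
    ∃ z, 0 ≤ z ∧ z ≤ h ∧ (∀ n, z ∈ W n) ∧ ε ≤ ‖z‖ := by
  -- `P i n` is the supremum of `g n, …, g (n + i)`. Finite suprema cost one index and the passage
  -- to `s n` another, whence `n + 2` in `hgW`.
  let P : ℕ → ℕ → F := fun i => Nat.rec g (fun _ Q n => g n ⊔ Q (n + 1)) i
  have hPg : ∀ i n, g n ≤ P i n := by
    intro i n
    cases i with
    | zero => exact le_rfl
    | succ i => exact le_sup_left
  have hPh : ∀ i n, P i n ≤ h := by
    intro i
    induction i with
    | zero => exact hgh
    | succ i ih => exact fun n => sup_le (hgh n) (ih _)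
  have hP0 : ∀ i n, 0 ≤ P i n := fun i n => (hg0 n).trans (hPg i n)
  have hPmono : ∀ n, Monotone fun i => P i n := fun n => monotone_nat_of_le_succ fun i => by
    induction i generalizing n with
    | zero => exact le_sup_left
    | succ i ih => exact sup_le_sup_left (ih _) _
  have hPW : ∀ i n, P i n ∈ W (n + 1) := by
    intro i
    induction i with
    | zero => exact fun n => hW.subset hN0 _ (hgW n)
    | succ i ih => exact fun n => hW.sup_mem (hg0 n) (hP0 _ _) (hgW n) (ih (n + 1))
  have hdir : ∀ n, DirectedOn (· ≤ ·) (Set.range fun i => P i n) := fun n =>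
    directedOn_range.2 (hPmono n).directed_le
  choose s hs using fun n => hF.exists_isLUB (Set.range_nonempty fun i => P i n) (hdir n)
    ⟨h, by rintro _ ⟨i, rfl⟩; exact hPh i n⟩
  have hgs : ∀ n, g n ≤ s n := fun n => (hs n).1 ⟨0, rfl⟩
  have hs0 : ∀ n, 0 ≤ s n := fun n => (hg0 n).trans (hgs n)
  have hsanti : Antitone s := antitone_nat_of_succ_le fun n => (hs (n + 1)).2 (by
    rintro _ ⟨i, rfl⟩
    exact le_sup_right.trans ((hs n).1 ⟨i + 1, rfl⟩))
  have hsW : ∀ n, s n ∈ W n := fun n => hW.isLUB_mem hND (Set.range_nonempty _) (hdir n) (hs n) (by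
    rintro _ ⟨i, rfl⟩
    exact hPW i n)
  have hsdir : DirectedOn (· ≥ ·) (Set.range s) := directedOn_range.2 hsanti.directed_ge
  obtain ⟨z, hz⟩ := hF.exists_isGLB (Set.range_nonempty s) hsdir
    ⟨0, by rintro _ ⟨n, rfl⟩; exact hs0 n⟩
  have hz0 : 0 ≤ z := hz.2 (by rintro _ ⟨n, rfl⟩; exact hs0 n)
  refine ⟨z, hz0, (hz.1 ⟨0, rfl⟩).trans ((hs 0).2 (by rintro _ ⟨i, rfl⟩; exact hPh i 0)),
    fun n => mem_of_isSolid (hW.solid n) (hsW n) hz0 (hz.1 ⟨n, rfl⟩), ?_⟩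
  refine le_of_forall_pos_le_add fun δ hδ => ?_
  obtain ⟨_, ⟨n, rfl⟩, hn⟩ := hF.exists_norm_lt (D := Set.range fun n => s n - z)
    (Set.range_nonempty _)
    (directedOn_range.2 (show Antitone fun n => s n - z from
      fun a b hab => sub_le_sub_right (hsanti hab) z).directed_ge)
    ⟨by rintro _ ⟨n, rfl⟩; exact sub_nonneg.2 (hz.1 ⟨n, rfl⟩), fun y hy => by
      have : z + y ≤ z := hz.2 (by
        rintro _ ⟨n, rfl⟩
        exact le_sub_iff_add_le'.1 (hy ⟨n, rfl⟩))
      simpa using this⟩ hδ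
  calc ε ≤ ‖g n‖ := hgε n
    _ ≤ ‖s n‖ := norm_le_norm_of_le (hg0 n) (hgs n)
    _ = ‖z + (s n - z)‖ := by congr 1; abel
    _ ≤ ‖z‖ + δ := (norm_add_le _ _).trans (by gcongr)

include hN hND hN0 in
/-- On order intervals of a Banach lattice with order continuous norm every Hausdorff order
continuous locally solid topology is at least as fine as the norm topology. -/
theorem OrderContinuous.setOf_norm_inf_lt_mem (hF : OrderContinuous F)
    (hNt : ∀ x : F, (∀ V ∈ N, x ∈ V) → x = 0) {h : F} (hh : 0 ≤ h) {ε : ℝ} (hε : 0 < ε) :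
    {g | ‖h ⊓ |g|‖ < ε} ∈ N := by
  by_contra hcon
  have hg : ∀ V ∈ N, ∃ g ∈ V, ε ≤ ‖h ⊓ |g|‖ := by
    intro V hV
    by_contra! hV'
    exact hcon (mem_of_superset hV hV')
  -- Each string `W` has a largest element of `[0, h]` in `⋂ W n`. Intersecting strings shows that
  -- these are directed downwards, and the separation hypothesis makes their infimum zero, so for
  -- some `W` it has norm below `ε`.
  obtain ⟨x, ⟨W, hW, hx⟩, hxε⟩ := hF.exists_norm_lt
    (D := {x | ∃ W, SolidString N W ∧ IsGreatest {x | 0 ≤ x ∧ x ≤ h ∧ ∀ n, x ∈ W n} x})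
    (by
      obtain ⟨W, hW, -⟩ := exists_solidString hN univ_mem
      obtain ⟨x, hx⟩ := hW.exists_isGreatest hND hN0 hF hh
      exact ⟨x, W, hW, hx⟩)
    (by
      rintro x ⟨W, hW, hx⟩ x' ⟨W', hW', hx'⟩
      have hWW : SolidString N fun n => W n ∩ W' n :=
        ⟨fun n => inter_mem (hW.mem n) (hW'.mem n),
          fun n a ha b hb => ⟨hW.solid n ha.1 hb, hW'.solid n ha.2 hb⟩,
          fun n a ha b hb => ⟨hW.add_mem n a ha.1 b hb.1, hW'.add_mem n a ha.2 b hb.2⟩⟩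
      obtain ⟨y, hy⟩ := hWW.exists_isGreatest hND hN0 hF hh
      exact ⟨y, ⟨_, hWW, hy⟩, hx.2 ⟨hy.1.1, hy.1.2.1, fun n => (hy.1.2.2 n).1⟩,
        hx'.2 ⟨hy.1.1, hy.1.2.1, fun n => (hy.1.2.2 n).2⟩⟩)
    (by
      refine ⟨fun x hx => ?_, fun y hy => ?_⟩
      · obtain ⟨W, -, hx⟩ := hx
        exact hx.1.1
      · refine posPart_eq_zero.1 (hNt _ fun V hV => ?_)
        obtain ⟨W, hW, hWV⟩ := exists_solidString hN hV
        obtain ⟨x, hx⟩ := hW.exists_isGreatest hND hN0 hF hh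
        have := hWV _ (mem_of_isSolid (hW.solid 0) (hx.1.2.2 0) (posPart_nonneg y)
          (sup_le (hy ⟨W, hW, hx⟩) hx.1.1)) 0 (hN0 _ (hW.mem 0))
        simpa using this) hε
  choose g hgW hgε using fun n => hg _ (hW.mem (n + 2))
  have hg0 : ∀ n, 0 ≤ h ⊓ |g n| := fun n => le_inf hh (abs_nonneg _)
  -- The limit superior lies in `⋂ W n` and in `[0, h]`, hence below `x`, yet has norm at least `ε`.
  obtain ⟨z, hz0, hzh, hzW, hzε⟩ := hW.exists_limsup hND hN0 hF (g := fun n => h ⊓ |g n|)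
    (fun n => hW.solid _ (hgW n) (by rw [abs_of_nonneg (hg0 n)]; exact inf_le_right))
    hg0 (fun n => inf_le_left) hgε
  have := norm_le_norm_of_le hz0 (hx.2 ⟨hz0, hzh, hzW⟩)
  linarith

end Amemiya

/-! ### Neighbourhoods in locally solid topologies -/

section LocallySolid

variable {G : Type*} [AddCommGroup G] [Lattice G] [Module ℝ G]
  {t : TopologicalSpace G} (ht : IsHausdorffOrderContinuousLocallySolid t)

include ht

theorem IsHausdorffOrderContinuousLocallySolid.exists_isSolid_add_mem {V : Set G}
    (hV : V ∈ @nhds G t 0) : ∃ W ∈ @nhds G t 0,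
      LatticeOrderedAddCommGroup.IsSolid W ∧ ∀ a ∈ W, ∀ b ∈ W, a + b ∈ V := by
  have := ht.isTopologicalAddGroup
  obtain ⟨U, hU, hUV⟩ := exists_nhds_zero_half hV
  obtain ⟨W, hW, hWs, hWU⟩ := ht.locallySolid U hU
  exact ⟨W, hW, hWs, fun a ha b hb => hUV a (hWU ha) b (hWU hb)⟩

theorem IsHausdorffOrderContinuousLocallySolid.eq_zero_of_forall_mem {x : G}
    (hx : ∀ V ∈ @nhds G t 0, x ∈ V) : x = 0 := by
  have := ht.t2Space
  by_contra h
  exact hx {x}ᶜ (isOpen_compl_singleton.mem_nhds (Ne.symm h)) rfl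

theorem IsHausdorffOrderContinuousLocallySolid.setOf_sub_mem_nhds {V : Set G}
    (hV : V ∈ @nhds G t 0) (f : G) : {g | g - f ∈ V} ∈ @nhds G t f := by
  have := ht.isTopologicalAddGroup
  have h : Tendsto (fun g => g - f) (@nhds G t f) (@nhds G t 0) := by
    simpa using (continuous_id.sub continuous_const).tendsto (f := fun g : G => g - f) f
  exact h hV

end LocallySolid

/-! ### The aw- and uaw-topologies, and `τ_F` -/

section UnboundedAbsoluteWeak

variable {F : Type*} [NormedAddCommGroup F] [Lattice F] [IsOrderedAddMonoid F]
  [NormedSpace ℝ F]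

theorem tendsto_awTopology_iff {α : Type*} {l : Filter α} {u : α → F} {f : F} :
    Tendsto u l (@nhds F (awTopology F) f) ↔
      ∀ ν : StrongDual ℝ F, PosFunctional F ν → Tendsto (fun a => ν |u a - f|) l (𝓝 0) :=
  (tendsto_iff_of_mem_nhds_iff (t := awTopology F)
    (ρ := fun (ν : {ν : StrongDual ℝ F // PosFunctional F ν}) f => ν.1 |f|)
    (fun U f => mem_nhds_awTopology.trans (by simp))
    fun ν f => ν.2 _ (abs_nonneg f)).trans Subtype.forall

/-- Index set of the functions generating the unbounded absolute weak topology. -/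
abbrev UawIndex (F : Type*) [NormedAddCommGroup F] [Lattice F] [NormedSpace ℝ F] : Type _ :=
  {h : F // 0 ≤ h} × {ν : StrongDual ℝ F // ∀ f : F, 0 ≤ f → 0 ≤ ν f}

/-- The functions generating the unbounded absolute weak topology. -/
def uawFunction (i : UawIndex F) (f : F) : ℝ := i.2.1 (i.1.1 ⊓ |f|)

theorem uawFunction_nonneg (i : UawIndex F) (f : F) : 0 ≤ uawFunction i f :=
  i.2.2 _ (le_inf i.1.2 (abs_nonneg f))

theorem mem_nhds_uawTopology_iff (U : Set F) (f : F) : U ∈ @nhds F (uawTopology F) f ↔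
    ∃ i : UawIndex F, ∃ ε > 0, ∀ g, uawFunction i (g - f) < ε → g ∈ U :=
  mem_nhds_uawTopology.trans ⟨fun ⟨h, hh, ν, hν, ε, hε, H⟩ => ⟨⟨⟨h, hh⟩, ⟨ν, hν⟩⟩, ε, hε, H⟩,
    fun ⟨i, ε, hε, H⟩ => ⟨i.1.1, i.1.2, i.2.1, i.2.2, ε, hε, H⟩⟩

theorem uawFunction_mono (i : UawIndex F) {f g : F} (h : |f| ≤ |g|) :
    uawFunction i f ≤ uawFunction i g :=
  PosFunctional.mono i.2.2 (inf_le_inf_left _ h)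

theorem uawFunction_add_le (i : UawIndex F) (f g : F) :
    uawFunction i (f + g) ≤ uawFunction i f + uawFunction i g := by
  rw [uawFunction, uawFunction, uawFunction, ← map_add]
  exact PosFunctional.mono i.2.2 ((inf_le_inf_left _ (abs_add_le f g)).trans
    (inf_add_le_inf_add_inf i.1.2 (abs_nonneg f) (abs_nonneg g)))

omit [IsOrderedAddMonoid F] in
theorem uawFunction_neg (i : UawIndex F) (f : F) : uawFunction i (-f) = uawFunction i f := by
  rw [uawFunction, abs_neg, uawFunction]

theorem uawFunction_zero (i : UawIndex F) : uawFunction i 0 = 0 := by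
  rw [uawFunction, abs_zero, inf_eq_right.2 i.1.2, map_zero]

theorem uawFunction_nsmul_le (i : UawIndex F) (n : ℕ) (f : F) :
    uawFunction i (n • f) ≤ n * uawFunction i f := by
  induction n with
  | zero => simp [uawFunction_zero]
  | succ n ih =>
    rw [succ_nsmul]
    push_cast
    linarith [uawFunction_add_le i (n • f) f]

theorem tendsto_uawTopology_zero_iff {α : Type*} {l : Filter α} {u : α → F} :
    Tendsto u l (@nhds F (uawTopology F) 0) ↔
      ∀ h : F, 0 ≤ h → ∀ ν : StrongDual ℝ F, PosFunctional F ν →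
        Tendsto (fun a => ν (h ⊓ |u a|)) l (𝓝 0) := by
  refine (tendsto_iff_of_mem_nhds_iff (t := uawTopology F) mem_nhds_uawTopology_iff
    uawFunction_nonneg).trans ?_
  simp only [sub_zero]
  exact ⟨fun H h hh ν hν => H ⟨⟨h, hh⟩, ⟨ν, hν⟩⟩, fun H i => H i.1.1 i.1.2 i.2.1 i.2.2⟩

variable [HasSolidNorm F] [IsOrderedModule ℝ F]

theorem isHausdorffOrderContinuousLocallySolid_uawTopology (hF : OrderContinuous F) :
    IsHausdorffOrderContinuousLocallySolid (uawTopology F) := by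
  have hgroup : @IsTopologicalAddGroup F (uawTopology F) _ :=
    isTopologicalAddGroup_of_mem_nhds_iff (t := uawTopology F) mem_nhds_uawTopology_iff
      uawFunction_nonneg uawFunction_add_le uawFunction_neg
  refine ⟨hgroup, ?_, ?_, fun U hU => ?_, fun l hl => ?_⟩
  · refine continuousSMul_of_mem_nhds_iff (t := uawTopology F) mem_nhds_uawTopology_iff
      uawFunction_nonneg uawFunction_add_le (fun i n c f hc => ?_) fun i f => ?_
    · calc uawFunction i (c • f) ≤ uawFunction i (n • |f|) := by
            refine uawFunction_mono i ((abs_smul_le c f).trans (le_trans ?_ (le_abs_self _)))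
            rw [← Nat.cast_smul_eq_nsmul ℝ]
            exact smul_le_smul_of_nonneg_right hc (abs_nonneg f)
        _ ≤ n * uawFunction i |f| := uawFunction_nsmul_le i n _
        _ = n * uawFunction i f := by rw [uawFunction, uawFunction, abs_abs]
    · refine squeeze_zero (fun _ => uawFunction_nonneg _ _)
        (fun c => (PosFunctional.mono i.2.2 (inf_le_right.trans (abs_smul_le c f)) :
          uawFunction i (c • f) ≤ i.2.1 (|c| • |f|))) ?_
      have : Continuous fun c : ℝ => i.2.1 (|c| • |f|) := by fun_prop
      simpa using this.tendsto 0
  · refine @IsTopologicalAddGroup.t2Space_of_zero_sep F (uawTopology F) _ hgroup fun x hx => ?_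
    obtain ⟨ν, hν, hpos⟩ := exists_posFunctional_pos (abs_nonneg x) (abs_ne_zero_of_ne_zero hx)
    exact ⟨{g | ν (|x| ⊓ |g|) < ν |x|}, mem_nhds_uawTopology.2
      ⟨|x|, abs_nonneg x, ν, hν, ν |x|, hpos, fun g hg => by simpa using hg⟩, by simp⟩
  · obtain ⟨i, ε, hε, H⟩ := (mem_nhds_uawTopology_iff U 0).1 hU
    refine ⟨{g | uawFunction i g < ε}, (mem_nhds_uawTopology_iff _ 0).2
      ⟨i, ε, hε, fun g hg => by simpa using hg⟩,
      fun f hf g hg => (uawFunction_mono i hg).trans_lt hf, fun g hg => H g (by simpa using hg)⟩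
  · refine (tendsto_uawTopology_zero_iff (u := id)).2 fun h hh ν hν => ?_
    have h1 : Tendsto (fun f : F => ν |f|) l (𝓝 0) := by
      have h2 : Continuous fun f : F => ν |f| :=
        ν.continuous.comp (continuous_id.sup continuous_neg)
      simpa using (h2.tendsto 0).mono_left (hF l hl)
    exact squeeze_zero (fun f => hν _ (le_inf hh (abs_nonneg f)))
      (fun f => hν.mono inf_le_right) h1

/-- In a Banach lattice with order continuous norm the unbounded absolute weak topology is the
weakest Hausdorff order continuous locally solid topology. -/
theorem isTauF_uawTopology [CompleteSpace F] (hF : OrderContinuous F) :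
    IsTauF (uawTopology F) := by
  refine ⟨isHausdorffOrderContinuousLocallySolid_uawTopology hF, fun s hs => ?_⟩
  rw [TopologicalSpace.le_def]
  intro U hU
  refine (@isOpen_iff_mem_nhds F s U).2 fun f hf => ?_
  obtain ⟨h, hh, ν, hν, ε, hε, H⟩ := hU f hf
  have hmem := hF.setOf_norm_inf_lt_mem (N := @nhds F s 0)
    (fun V hV => hs.exists_isSolid_add_mem hV)
    (fun D hD hdir h0 V hV => by
      obtain ⟨d, hd, hdV⟩ := exists_mem_of_orderContinuousTopology hs.orderContinuous hD hdir h0 hV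
      exact ⟨d, hd, hdV d (abs_of_nonneg (h0.1 hd)).le⟩)
    (fun V hV => @mem_of_mem_nhds F s 0 V hV) (fun x hx => hs.eq_zero_of_forall_mem hx) hh
    -- Chosen so that norm smallness of `h ⊓ |g - f|` yields `ν (h ⊓ |g - f|) < ε`; the `+ 1` covers
    -- `ν = 0`.
    (ε := ε / (‖ν‖ + 1)) (by positivity)
  filter_upwards [hs.setOf_sub_mem_nhds hmem f] with g hg
  refine H g ?_
  have hg' : ‖h ⊓ |g - f|‖ < ε / (‖ν‖ + 1) := hg
  rw [lt_div_iff₀ (by positivity)] at hg'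
  have h1 := (le_abs_self _).trans (ν.le_opNorm (h ⊓ |g - f|))
  nlinarith [norm_nonneg (h ⊓ |g - f|)]

theorem PositiveSchur.tendsto_norm_of_tendsto_uawTopology [CompleteSpace F]
    (hF : PositiveSchur F) {u : ℕ → F} (hu : WeaklyNull u)
    (hu' : Tendsto u atTop (@nhds F (uawTopology F) 0)) :
    Tendsto (fun n => ‖u n‖) atTop (𝓝 0) :=
  hF.tendsto_norm fun _ hν => hu.tendsto_posFunctional_abs hν fun h hh =>
    tendsto_uawTopology_zero_iff.1 hu' h hh _ hν

omit [IsOrderedModule ℝ F] in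
theorem PositiveSchur.tendsto_awTopology_iff (hF : PositiveSchur F) {u : ℕ → F} {f : F} :
    Tendsto u atTop (@nhds F (awTopology F) f) ↔ Tendsto u atTop (𝓝 f) := by
  rw [BanachLattice.tendsto_awTopology_iff, tendsto_iff_norm_sub_tendsto_zero]
  refine ⟨hF.tendsto_norm, fun h ν _ => ?_⟩
  have h1 := (ν.continuous.tendsto 0).comp (tendsto_zero_iff_norm_tendsto_zero.2
    (by simpa only [norm_abs_eq_norm] using h : Tendsto (fun n => ‖|u n - f|‖) atTop (𝓝 0)))
  rwa [map_zero] at h1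

omit [HasSolidNorm F] [IsOrderedModule ℝ F] in
theorem positiveSchur_of_tendsto_awTopology (h : ∀ u : ℕ → F,
    Tendsto u atTop (@nhds F (awTopology F) 0) → Tendsto u atTop (𝓝 0)) : PositiveSchur F := by
  intro u hu hw
  refine tendsto_zero_iff_norm_tendsto_zero.1 (h u (tendsto_awTopology_iff.2 fun ν _ => ?_))
  simpa only [sub_zero, abs_of_nonneg (hu _)] using weaklyNull_iff.1 hw ν

omit [HasSolidNorm F] [IsOrderedModule ℝ F] in
theorem positiveSchur_of_tendsto_uawTopology (h : ∀ u : ℕ → F, WeaklyNull u →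
    Tendsto u atTop (@nhds F (uawTopology F) 0) → Tendsto (fun n => ‖u n‖) atTop (𝓝 0)) :
    PositiveSchur F := by
  intro u hu hw
  refine h u hw (tendsto_uawTopology_zero_iff.2 fun k hk ν hν => ?_)
  refine squeeze_zero (fun n => hν _ (le_inf hk (abs_nonneg _)))
    (fun n => hν.mono inf_le_right) ?_
  simpa only [abs_of_nonneg (hu _)] using weaklyNull_iff.1 hw ν

end UnboundedAbsoluteWeak

end BanachLattice

/-! ### The main theorem -/

theorem mainTheorem10 {F : Type*} [NormedAddCommGroup F] [Lattice F] [IsOrderedAddMonoid F]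
    [HasSolidNorm F] [NormedSpace ℝ F] [IsOrderedModule ℝ F] [CompleteSpace F] :
    List.TFAE [
      BanachLattice.PositiveSchur F,
      ∀ (u : ℕ → F) (f : F),
        Tendsto u atTop (@nhds F (BanachLattice.awTopology F) f) ↔ Tendsto u atTop (𝓝 f),
      BanachLattice.OrderContinuous F ∧
        ∃ t : TopologicalSpace F, BanachLattice.IsTauF t ∧
          ∀ u : ℕ → F, BanachLattice.WeaklyNull u → Tendsto u atTop (@nhds F t 0) →
            Tendsto (fun n => ‖u n‖) atTop (𝓝 0),
      ∀ u : ℕ → F, BanachLattice.WeaklyNull u →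
        Tendsto u atTop (@nhds F (BanachLattice.uawTopology F) 0) →
          Tendsto (fun n => ‖u n‖) atTop (𝓝 0)] ∧
    (BanachLattice.PositiveSchur F →
      (∀ E : Submodule ℝ F, IsClosed (E : Set F) → BanachLattice.Reflexive E →
        BanachLattice.Dispersed E) ∧
      (∀ (H : Type*) [NormedAddCommGroup H] [NormedSpace ℝ H] [CompleteSpace H] (T : F →L[ℝ] H),
        BanachLattice.Tauberian T → BanachLattice.DisjointlyNonSingular T) ∧
      (∀ e : ℕ → F, BanachLattice.AlmostDisjointSeq e →
        ¬ BanachLattice.Reflexive (Submodule.span ℝ (Set.range e)).topologicalClosure) ∧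
      (∀ f : ℕ → F, BanachLattice.DisjointSeq f → (∀ n, f n ≠ 0) →
        ¬ BanachLattice.Reflexive (Submodule.span ℝ (Set.range f)).topologicalClosure)) := by
  have hmem : ∀ (e : ℕ → F) n, e n ∈ (Submodule.span ℝ (Set.range e)).topologicalClosure :=
    fun e n => Submodule.le_topologicalClosure _ (Submodule.subset_span ⟨n, rfl⟩)
  refine ⟨?_, fun hF => ⟨fun E _ hE => hF.dispersed E hE,
    fun H _ _ _ T hT => hF.disjointlyNonSingular hT,
    fun e he => hF.not_reflexive_of_almostDisjointSeq he _ (hmem e),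
    fun f hf hf0 => hF.not_reflexive_of_disjointSeq hf hf0 _ (hmem f)⟩⟩
  tfae_have 1 → 2 := fun hF u f => hF.tendsto_awTopology_iff
  tfae_have 2 → 1 := fun h =>
    BanachLattice.positiveSchur_of_tendsto_awTopology fun u => (h u 0).1
  tfae_have 1 → 3 := fun hF =>
    ⟨hF.orderContinuous, _, BanachLattice.isTauF_uawTopology hF.orderContinuous,
      fun _ hu hu' => hF.tendsto_norm_of_tendsto_uawTopology hu hu'⟩
  tfae_have 3 → 4 := by
    rintro ⟨hF, t, ht, h⟩
    rw [(BanachLattice.isTauF_uawTopology hF).unique ht]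
    exact h
  tfae_have 4 → 1 := BanachLattice.positiveSchur_of_tendsto_uawTopology
  tfae_finish
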